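/- Theorem 2.11 (label lessm). For a finite set $J$ of positive integers let $\mathcal{H}_\infty^{J}((\log n))$ be the finite dimensional complex Banach space of all Dirichlet polynomials $D(s)=\sum_{k\in J} a_k k^{-s}$ ($a_k\in\mathbb{C}$), normed by $\|D\|_\infty=\sup_{t\in\mathbb{R}}|D(it)|$. For a closed subspace $X$ of a complex Banach space $Y$ let $\boldsymbol{\lambda}(X,Y)\in[0,\infty]$ be the infimum of the norms of the bounded linear projections of $Y$ onto $X$, and for a complex Banach space $X$ let $\boldsymbol{\lambda}(X)=\sup\boldsymbol{\lambda}(I(X),Y)$, where the supremum is taken over all complex Banach spaces $Y$ and all isometric linear embeddings $I\colon X\to Y$ such that $I(X)$ is complemented in $Y$. Let $\mathfrak{p}_1<\mathfrak{p}_2<\cdots$ be the sequence of prime numbers, and for $m,n\in\mathbb{N}=\{1,2,\dots\}$ put \[ N_1(\le m,n)=\Big\{\mathfrak{p}_1^{\alpha_1}\cdots\mathfrak{p}_n^{\alpha_n} : \alpha\in\mathbb{N}_0^n,\ |\alpha|=\alpha_1+\cdots+\alpha_n\le m\Big\}. \] Then for all $m,n\in\mathbb{N}$ \[ \frac{1}{\sqrt{2^{m}}}\left(\sum_{k=0}^m\binom{n+k-1}{k}\right)^{\frac12}\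 \le\ \boldsymbol{\lambda}\big(\mathcal{H}_\infty^{N_1(\le m,n)}((\log n))\big)\ \le\ \left(\sum_{k=0}^m\binom{n+k-1}{k}\right)^{\frac12}. \] -/

import Mathlib

open scoped ENNReal

universe u v

/-! ### Projection constants -/

/-- The relative projection constant of a subspace `X` of a complex Banach space `Y`: the infimum
of the norms of all bounded linear projections of `Y` onto `X` (it is `∞` if there are none). -/
noncomputable def relProjConst {Y : Type v} [NormedAddCommGroup Y] [NormedSpace ℂ Y]
    (X : Submodule ℂ Y) : ℝ≥0∞ :=
  ⨅ (P : Y →L[ℂ] X) (_ : ∀ x : X, P (x : Y) = x), ‖P‖ₑ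

/-- The (absolute) projection constant of a complex Banach space `X`: the supremum of the relative
projection constants of `I(X)` in `Y`, over all complex Banach spaces `Y` and all isometric
embeddings `I : X → Y` such that `I(X)` is complemented in `Y`. -/
noncomputable def projConst (X : Type u) [NormedAddCommGroup X] [NormedSpace ℂ X] : ℝ≥0∞ :=
  ⨆ (Y : Type v) (_ : NormedAddCommGroup Y) (_ : NormedSpace ℂ Y) (_ : CompleteSpace Y)
    (I : X →ₗᵢ[ℂ] Y) (_ : (LinearMap.range I.toLinearMap).ClosedComplemented),
    relProjConst (LinearMap.range I.toLinearMap)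

/-! ### Spaces of Dirichlet polynomials -/

/-- The vector space of all `ω`-Dirichlet polynomials `s ↦ ∑ a_n exp (-ω_n s)` supported on the
index set `J`, as functions on the complex plane. -/
def dirichletPolynomials (ω : ℕ → ℝ) (J : Set ℕ) : Submodule ℂ (ℂ → ℂ) :=
  Submodule.span ℂ ((fun (n : ℕ) (s : ℂ) => Complex.exp (-(ω n : ℂ) * s)) '' J)

theorem dirichletPolynomials_differentiable {ω : ℕ → ℝ} {J : Set ℕ} {D : ℂ → ℂ}
    (hD : D ∈ dirichletPolynomials ω J) : Differentiable ℂ D := by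
  induction hD using Submodule.span_induction with
  | mem x hx =>
    obtain ⟨n, -, rfl⟩ := hx
    fun_prop
  | zero => exact differentiable_const (0 : ℂ)
  | add x y _ _ hx hy => exact hx.add hy
  | smul a x _ hx => exact hx.const_smul a

theorem dirichletPolynomials_bounded {ω : ℕ → ℝ} {J : Set ℕ} {D : ℂ → ℂ}
    (hD : D ∈ dirichletPolynomials ω J) :
    BddAbove (Set.range fun t : ℝ => ‖D (t * Complex.I)‖) := by
  suffices h : ∃ C : ℝ, ∀ t : ℝ, ‖D (t * Complex.I)‖ ≤ C by
    obtain ⟨C, hC⟩ := h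
    exact ⟨C, by rintro _ ⟨t, rfl⟩; exact hC t⟩
  induction hD using Submodule.span_induction with
  | mem x hx =>
    obtain ⟨n, -, rfl⟩ := hx
    refine ⟨1, fun t => le_of_eq ?_⟩
    simp [Complex.norm_exp]
  | zero => exact ⟨0, fun t => by simp⟩
  | add x y _ _ hx hy =>
    obtain ⟨C, hC⟩ := hx
    obtain ⟨C', hC'⟩ := hy
    exact ⟨C + C', fun t => (norm_add_le _ _).trans (add_le_add (hC t) (hC' t))⟩
  | smul a x _ hx =>
    obtain ⟨C, hC⟩ := hx
    refine ⟨‖a‖ * C, fun t => ?_⟩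
    simpa using mul_le_mul_of_nonneg_left (hC t) (norm_nonneg a)

theorem dirichletPolynomials_eq_zero {ω : ℕ → ℝ} {J : Set ℕ} {D : ℂ → ℂ}
    (hD : D ∈ dirichletPolynomials ω J) (h : ∀ t : ℝ, D (t * Complex.I) = 0) : D = 0 := by
  have hd : AnalyticOnNhd ℂ D Set.univ :=
    (dirichletPolynomials_differentiable hD).differentiableOn.analyticOnNhd isOpen_univ
  have h0 : AnalyticOnNhd ℂ (0 : ℂ → ℂ) Set.univ := analyticOnNhd_const
  refine hd.eq_of_frequently_eq h0 (z₀ := 0) ?_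
  have ht : Filter.Tendsto (fun k : ℕ => (((1 / ((k : ℝ) + 1) : ℝ) : ℂ) * Complex.I))
      Filter.atTop (nhdsWithin 0 {0}ᶜ) := by
    refine tendsto_nhdsWithin_iff.2 ⟨?_, Filter.Eventually.of_forall fun k => ?_⟩
    · have h1 := (Complex.continuous_ofReal.tendsto 0).comp
        (tendsto_one_div_add_atTop_nhds_zero_nat (𝕜 := ℝ))
      simpa using h1.mul_const Complex.I
    · have hk : ((k : ℂ) + 1) ≠ 0 := Nat.cast_add_one_ne_zero k
      simp [hk]
  exact ht.frequently (Filter.Frequently.of_forall fun k => h _)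

/-- The space `𝓗_∞^J(ω)` of `ω`-Dirichlet polynomials supported on `J`; its norm is introduced
below. -/
def HInf (ω : ℕ → ℝ) (J : Set ℕ) : Type := dirichletPolynomials ω J

namespace HInf

variable {ω : ℕ → ℝ} {J : Set ℕ}

noncomputable instance : AddCommGroup (HInf ω J) :=
  inferInstanceAs (AddCommGroup (dirichletPolynomials ω J))

noncomputable instance : Module ℂ (HInf ω J) :=
  inferInstanceAs (Module ℂ (dirichletPolynomials ω J))

/-- The Dirichlet polynomial as a function on the complex plane. -/
def toFun (D : HInf ω J) : ℂ → ℂ := Subtype.val D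

/-- The norm `‖D‖_∞ = sup_{t ∈ ℝ} |D(it)|`. -/
noncomputable instance : Norm (HInf ω J) := ⟨fun D => ⨆ t : ℝ, ‖D.toFun (t * Complex.I)‖⟩

theorem norm_def (D : HInf ω J) : ‖D‖ = ⨆ t : ℝ, ‖D.toFun (t * Complex.I)‖ := rfl

theorem core : NormedSpace.Core ℂ (HInf ω J) where
  norm_nonneg D := Real.iSup_nonneg fun _ => norm_nonneg _
  norm_smul c D := by
    rw [norm_def, norm_def, Real.mul_iSup_of_nonneg (norm_nonneg c)]
    exact congrArg iSup (funext fun t => norm_smul c (D.toFun (t * Complex.I)))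
  norm_triangle D E := by
    rw [norm_def]
    refine ciSup_le fun t => (norm_add_le (D.toFun _) (E.toFun _)).trans ?_
    exact add_le_add (le_ciSup (dirichletPolynomials_bounded D.2) t)
      (le_ciSup (dirichletPolynomials_bounded E.2) t)
  norm_eq_zero_iff D := by
    constructor
    · intro h
      refine Subtype.ext (dirichletPolynomials_eq_zero D.2 fun t => norm_le_zero_iff.1 ?_)
      exact (le_ciSup (dirichletPolynomials_bounded D.2) t).trans (le_of_eq h)
    · rintro rfl
      rw [norm_def]
      have h0 : ∀ t : ℝ, ‖(0 : HInf ω J).toFun (t * Complex.I)‖ = 0 := fun t => norm_zero (E := ℂ)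
      simp [h0]

noncomputable instance : NormedAddCommGroup (HInf ω J) := NormedAddCommGroup.ofCore core

noncomputable instance : NormedSpace ℂ (HInf ω J) := NormedSpace.ofCore core

end HInf

/-! ### The index sets -/

/-- The frequency `(log n)`, for `n = 1, 2, 3, …`; the value at `n = 0` is irrelevant, because all
index sets below consist of positive integers. -/
noncomputable def logFrequency (n : ℕ) : ℝ := Real.log n

/-- The multi-indices `α ∈ ℕ₀ⁿ` of order `|α| = α_1 + ⋯ + α_n` at most `m`. -/
def multiIndicesLE (m n : ℕ) : Set (Fin n → ℕ) := {α | ∑ j, α j ≤ m}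

/-- `𝔭^α = p_1^{α_1} ⋯ p_n^{α_n}`, where `p_1 < p_2 < ⋯` is the sequence of the prime numbers. -/
noncomputable def primePow {n : ℕ} (α : Fin n → ℕ) : ℕ :=
  ∏ j : Fin n, Nat.nth Nat.Prime (j : ℕ) ^ α j

/-- The positive integers `k = 𝔭^α` with `α ∈ ℕ₀ⁿ` and `|α| ≤ m`. -/
def primePowIndices (m n : ℕ) : Set ℕ := {k | ∃ α ∈ multiIndicesLE m n, k = primePow α}

/-! Let Λ be the set of multi-indices of order at most `m`, N its cardinality and K the sum of the
characters indexed by Λ. Unique factorization makes the frequencies of distinct integer exponents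
distinct. A generic step h then makes the averages of every nontrivial character over the times 0,
h, 2h, … tend to zero (`tendsto_mean_primeChar`), which replaces integration over the torus.

Upper bound (`exists_projection`): Hahn–Banach extends each point evaluation from the embedded copy
to a functional of norm at most one on Y. Averaging these functionals against characters, with an
ultrafilter limit, yields Fourier coefficients of every y in Y, and hence a projection. Its value at
a point is a limiting average against a translate of K, so by Cauchy–Schwarz its norm is at most the
L² norm of K, which is √N.

Lower bound: embed into the bounded continuous functions on ℝ and let Q be a projection of norm C.
Averaging Q over translations, as in Rudin's argument, bounds the sum over Λ of the coefficients of
a trigonometric polynomial F by C times the sup of F (`norm_sum_coeff_le`). When F approximates the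
phase of K, this sum approximates the L¹ norm of K, so that norm is at most C.

It remains to see that N / 2 ^ m is at most ‖K‖₁² (`card_div_two_pow_le`). This follows from the
contractive inequality ∑ |a_α|² / 2 ^ |α| ≤ ‖f‖₁². In one variable, write f = u v with |u|² = |v|² =
|f| on the circle. The coefficients of f are convolutions, so Cauchy–Schwarz and k + 1 ≤ 2 ^ k bound
the left side by ‖u‖₂² ‖v‖₂² = ‖f‖₁² (`sum_norm_sq_div_two_pow_le`). Minkowski's inequality passes
to several variables (`sum_norm_sq_div_two_pow_sum_le`). All L¹ norms are means over grids of roots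
of unity, with an error factor that tends to 1. -/

/-! ### Power series with absolutely summable coefficients -/

namespace PowerSeries

/-- The coefficients of the power series are absolutely summable. -/
def AbsSummable (f : PowerSeries ℂ) : Prop := Summable fun n => ‖coeff n f‖

/-- The sum of the power series at a point. -/
noncomputable def sumAt (f : PowerSeries ℂ) (z : ℂ) : ℂ := ∑' n, coeff n f * z ^ n

theorem AbsSummable.norm_mul_pow {f : PowerSeries ℂ} (hf : f.AbsSummable) {z : ℂ} (hz : ‖z‖ = 1) :
    Summable fun n => ‖coeff n f * z ^ n‖ := by
  simpa [hz, AbsSummable] using hf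

theorem coeff_mul_mul_pow (f g : PowerSeries ℂ) (z : ℂ) (n : ℕ) :
    coeff n (f * g) * z ^ n =
      ∑ kl ∈ Finset.HasAntidiagonal.antidiagonal n, (coeff kl.1 f * z ^ kl.1) * (coeff kl.2 g * z ^ kl.2) := by
  rw [coeff_mul, Finset.sum_mul]
  refine Finset.sum_congr rfl fun kl hkl => ?_
  rw [← Finset.HasAntidiagonal.mem_antidiagonal.1 hkl, pow_add]
  ring

theorem AbsSummable.mul {f g : PowerSeries ℂ} (hf : f.AbsSummable) (hg : g.AbsSummable) :
    (f * g).AbsSummable := by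
  have h := summable_norm_sum_mul_antidiagonal_of_summable_norm hf hg
  simpa [AbsSummable, coeff_mul] using h

theorem AbsSummable.sumAt_mul {f g : PowerSeries ℂ} (hf : f.AbsSummable) (hg : g.AbsSummable)
    {z : ℂ} (hz : ‖z‖ = 1) : (f * g).sumAt z = f.sumAt z * g.sumAt z := by
  unfold sumAt
  rw [tsum_mul_tsum_eq_tsum_sum_antidiagonal_of_summable_norm (hf.norm_mul_pow hz)
    (hg.norm_mul_pow hz)]
  exact tsum_congr fun n => coeff_mul_mul_pow f g z n

theorem absSummable_coe (p : Polynomial ℂ) : (p : PowerSeries ℂ).AbsSummable := by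
  refine summable_of_ne_finset_zero (s := p.support) fun n hn => ?_
  simpa using hn

theorem sumAt_coe (p : Polynomial ℂ) (z : ℂ) : (p : PowerSeries ℂ).sumAt z = p.eval z := by
  unfold sumAt
  rw [tsum_eq_sum (s := p.support) fun n hn => ?_, Polynomial.eval_eq_sum, Polynomial.sum]
  · simp
  · have : p.coeff n = 0 := by simpa using hn
    simp [this]

/-- Consecutive binomial coefficients have ratio (r - n) / (n + 1), of modulus at most one. The case
needed is r = ±1/2; a geometric series then dominates the coefficients of (1 - b z) ^ r for |b| < 1.
-/
theorem norm_choose_le_one (r : ℂ) (hr : ∀ k : ℕ, ‖r - k‖ ≤ k + 1) (n : ℕ) :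
    ‖Ring.choose r n‖ ≤ 1 := by
  induction n with
  | zero => simp
  | succ n ih =>
    have h : Ring.choose r (n + 1) = Ring.choose r n * (r - n) / (n + 1) := by
      rw [Ring.choose_eq_smul, Ring.choose_eq_smul, descPochhammer_succ_right,
        Polynomial.smeval_mul, Polynomial.smeval_sub, Polynomial.smeval_X,
        Polynomial.smeval_natCast, Nat.factorial_succ]
      have h1 : ((n : ℂ) + 1) ≠ 0 := Nat.cast_add_one_ne_zero n
      have h2 : (n.factorial : ℂ) ≠ 0 := by exact_mod_cast n.factorial_ne_zero
      simp only [smul_eq_mul, Nat.cast_mul, Nat.cast_add, Nat.cast_one, pow_one, pow_zero, nsmul_eq_mul, mul_one]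
      field_simp
    have h3 : ‖(n : ℂ) + 1‖ = n + 1 := by
      exact_mod_cast Complex.norm_natCast (n + 1)
    rw [h, norm_div, norm_mul, h3, div_le_one (by positivity)]
    calc ‖Ring.choose r n‖ * ‖r - n‖ ≤ 1 * (n + 1) := by
          gcongr
          exact hr n
      _ = n + 1 := one_mul _

/-- The binomial series of `(1 - b z) ^ r`. -/
noncomputable def oneSubPow (r b : ℂ) : PowerSeries ℂ := rescale (-b) (binomialSeries ℂ r)

theorem absSummable_oneSubPow {r b : ℂ} (hr : ∀ k : ℕ, ‖r - k‖ ≤ k + 1) (hb : ‖b‖ < 1) :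
    (oneSubPow r b).AbsSummable := by
  refine Summable.of_nonneg_of_le (fun _ => norm_nonneg _) (fun n => ?_)
    (summable_geometric_of_lt_one (norm_nonneg b) hb)
  rw [oneSubPow, coeff_rescale, binomialSeries_coeff]
  simpa using mul_le_mul_of_nonneg_left (norm_choose_le_one r hr n) (pow_nonneg (norm_nonneg b) n)

theorem oneSubPow_half_mul_self (b : ℂ) :
    oneSubPow (1 / 2) b * oneSubPow (1 / 2) b = ((1 - Polynomial.C b * Polynomial.X :
      Polynomial ℂ) : PowerSeries ℂ) := by
  have h : binomialSeries ℂ (1 / 2 : ℂ) * binomialSeries ℂ (1 / 2 : ℂ) = 1 + X := by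
    rw [← binomialSeries_add]
    have := binomialSeries_nat (R := ℂ) (A := ℂ) 1
    norm_num at this ⊢
    exact this
  rw [oneSubPow, ← map_mul, h, map_add, map_one, rescale_X]
  simp [sub_eq_add_neg]

theorem oneSubPow_neg_half_mul (b : ℂ) : oneSubPow (-1 / 2) b * oneSubPow (1 / 2) b = 1 := by
  have h : binomialSeries ℂ (-1 / 2 : ℂ) * binomialSeries ℂ (1 / 2 : ℂ) = 1 := by
    rw [← binomialSeries_add]
    have := binomialSeries_nat (R := ℂ) (A := ℂ) 0
    norm_num at this ⊢
  rw [oneSubPow, oneSubPow, ← map_mul, h, map_one]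

theorem norm_half_sub_le (k : ℕ) : ‖(1 / 2 : ℂ) - k‖ ≤ k + 1 := by
  refine (norm_sub_le _ _).trans ?_
  norm_num
  linarith

theorem norm_neg_half_sub_le (k : ℕ) : ‖(-1 / 2 : ℂ) - k‖ ≤ k + 1 := by
  refine (norm_sub_le _ _).trans ?_
  norm_num
  linarith

end PowerSeries

/-! ### Balanced factorizations on the unit circle -/

open PowerSeries in
/-- The polynomial `f` is a product of two power series with absolutely summable coefficients, both
of modulus `√|f|` on the unit circle. -/
def HasBalancedFactorization (f : Polynomial ℂ) : Prop :=
  ∃ u v : PowerSeries ℂ, u.AbsSummable ∧ v.AbsSummable ∧ u * v = f ∧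
    ∀ z : ℂ, ‖z‖ = 1 → ‖u.sumAt z‖ ^ 2 = ‖f.eval z‖ ∧ ‖v.sumAt z‖ ^ 2 = ‖f.eval z‖

namespace HasBalancedFactorization

open PowerSeries

theorem mul {f g : Polynomial ℂ} (hf : HasBalancedFactorization f)
    (hg : HasBalancedFactorization g) : HasBalancedFactorization (f * g) := by
  obtain ⟨u, v, hu, hv, huv, h⟩ := hf
  obtain ⟨u', v', hu', hv', huv', h'⟩ := hg
  refine ⟨u * u', v * v', hu.mul hu', hv.mul hv', ?_, fun z hz => ?_⟩
  · rw [mul_mul_mul_comm, huv, huv', Polynomial.coe_mul]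
  · rw [hu.sumAt_mul hu' hz, hv.sumAt_mul hv' hz, norm_mul, norm_mul, mul_pow, mul_pow,
      (h z hz).1, (h z hz).2, (h' z hz).1, (h' z hz).2, Polynomial.eval_mul, norm_mul]
    exact ⟨rfl, rfl⟩

theorem of_sq {f : Polynomial ℂ} {u : PowerSeries ℂ} (hu : u.AbsSummable) (h : u * u = f) :
    HasBalancedFactorization f := by
  have h2 (z : ℂ) (hz : ‖z‖ = 1) : ‖u.sumAt z‖ ^ 2 = ‖f.eval z‖ := by
    rw [← sumAt_coe, ← h, hu.sumAt_mul hu hz, norm_mul, sq]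
  exact ⟨u, u, hu, hu, h, fun z hz => ⟨h2 z hz, h2 z hz⟩⟩

theorem const (c : ℂ) : HasBalancedFactorization (Polynomial.C c) := by
  obtain ⟨d, hd⟩ := IsAlgClosed.exists_pow_nat_eq c (n := 2) (by norm_num)
  refine of_sq (absSummable_coe (Polynomial.C d)) ?_
  rw [← Polynomial.coe_mul, ← Polynomial.C_mul, ← sq, hd]

theorem one_sub {b : ℂ} (hb : ‖b‖ < 1) :
    HasBalancedFactorization (1 - Polynomial.C b * Polynomial.X) :=
  of_sq (absSummable_oneSubPow norm_half_sub_le hb) (oneSubPow_half_mul_self b)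

theorem X_sub_of_one_lt {a : ℂ} (ha : 1 < ‖a‖) :
    HasBalancedFactorization (Polynomial.X - Polynomial.C a) := by
  have h0 : a ≠ 0 := by
    rintro rfl
    simp at ha
    linarith
  have h : (Polynomial.X - Polynomial.C a : Polynomial ℂ) =
      Polynomial.C (-a) * (1 - Polynomial.C a⁻¹ * Polynomial.X) := by
    rw [mul_sub, ← mul_assoc, ← Polynomial.C_mul]
    simp [h0]
    ring
  rw [h]
  refine (const _).mul (one_sub ?_)
  rw [norm_inv]
  exact inv_lt_one_of_one_lt₀ ha

/-- A zero inside the disc rules out an analytic square root. With b the conjugate of a, however, |z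
- a| = |1 - b z| on the circle, so v = (1 - b z) ^ (1/2) has the right modulus, and u = (z - a) (1 -
b z) ^ (-1/2) takes the Blaschke factor. -/
theorem X_sub_of_lt_one {a : ℂ} (ha : ‖a‖ < 1) :
    HasBalancedFactorization (Polynomial.X - Polynomial.C a) := by
  set b := (starRingEnd ℂ) a with hb
  have hb1 : ‖b‖ < 1 := by simpa [hb] using ha
  have hs := absSummable_oneSubPow norm_half_sub_le hb1
  have ht := absSummable_oneSubPow norm_neg_half_sub_le hb1
  have hp := absSummable_coe (Polynomial.X - Polynomial.C a)
  have hfac : ((Polynomial.X - Polynomial.C a : Polynomial ℂ) : PowerSeries ℂ) *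
      oneSubPow (-1 / 2) b * oneSubPow (1 / 2) b =
        ((Polynomial.X - Polynomial.C a : Polynomial ℂ) : PowerSeries ℂ) := by
    rw [mul_assoc, oneSubPow_neg_half_mul, mul_one]
  refine ⟨_, _, hp.mul ht, hs, hfac, fun z hz => ?_⟩
  have h1 : ‖z - a‖ = ‖1 - b * z‖ := by
    have hzz : (starRingEnd ℂ) z * z = 1 := by
      rw [mul_comm, Complex.mul_conj, Complex.normSq_eq_norm_sq, hz]
      norm_num
    have : 1 - b * z = (starRingEnd ℂ) (z - a) * z := by
      rw [map_sub, sub_mul, hzz]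
    rw [this, norm_mul, hz, mul_one, Complex.norm_conj]
  have h2 : ‖(oneSubPow (1 / 2) b).sumAt z‖ ^ 2 = ‖z - a‖ := by
    rw [sq, ← norm_mul, ← hs.sumAt_mul hs hz, oneSubPow_half_mul_self, sumAt_coe, h1]
    simp
  have h3 : ‖(((Polynomial.X - Polynomial.C a : Polynomial ℂ) : PowerSeries ℂ) *
      oneSubPow (-1 / 2) b).sumAt z‖ * ‖(oneSubPow (1 / 2) b).sumAt z‖ = ‖z - a‖ := by
    rw [← norm_mul, ← (hp.mul ht).sumAt_mul hs hz, hfac, sumAt_coe]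
    simp
  have h4 : ‖z - a‖ ≠ 0 := by
    intro h
    rw [norm_eq_zero, sub_eq_zero] at h
    rw [← h, hz] at ha
    exact lt_irrefl _ ha
  have h5 : ‖(((Polynomial.X - Polynomial.C a : Polynomial ℂ) : PowerSeries ℂ) *
      oneSubPow (-1 / 2) b).sumAt z‖ ^ 2 = ‖z - a‖ := by
    have := congrArg (· ^ 2) h3
    simp only [mul_pow, h2] at this
    rw [sq ‖z - a‖] at this
    exact mul_right_cancel₀ h4 this
  rw [Polynomial.eval_sub, Polynomial.eval_X, Polynomial.eval_C]
  exact ⟨h5, h2⟩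

/-- Balanced factorizations multiply, so linear factors suffice. Roots on the circle are excluded
because the binomial series is only controlled for |b| < 1. -/
theorem of_forall_root {f : Polynomial ℂ} (hf : ∀ a ∈ f.roots, ‖a‖ ≠ 1) :
    HasBalancedFactorization f := by
  have h : ∀ s : Multiset ℂ, (∀ a ∈ s, ‖a‖ ≠ 1) →
      HasBalancedFactorization (s.map fun a => Polynomial.X - Polynomial.C a).prod := by
    intro s
    induction s using Multiset.induction with
    | empty => intro _; simpa using const 1
    | cons a s ih =>
      intro hs
      rw [Multiset.map_cons, Multiset.prod_cons]
      refine mul ?_ (ih fun b hb => hs b (Multiset.mem_cons_of_mem hb))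
      rcases lt_or_gt_of_ne (hs a (Multiset.mem_cons_self a s)) with h | h
      · exact X_sub_of_lt_one h
      · exact X_sub_of_one_lt h
  rw [(IsAlgClosed.splits f).eq_prod_roots]
  exact (const _).mul (h _ hf)

end HasBalancedFactorization

/-! ### Averages over roots of unity -/

/-- The `j`-th root of unity of order `M`. -/
noncomputable def unitRoot (M : ℕ) (j : Fin M) : ℂ :=
  Complex.exp (2 * Real.pi * Complex.I / M) ^ (j : ℕ)

theorem norm_exp_two_pi_I_div (M : ℕ) : ‖Complex.exp (2 * Real.pi * Complex.I / M)‖ = 1 := by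
  have : (2 * Real.pi * Complex.I / M : ℂ) = ((2 * Real.pi / M : ℝ) : ℂ) * Complex.I := by
    push_cast
    ring
  rw [this, Complex.norm_exp_ofReal_mul_I]

theorem norm_unitRoot (M : ℕ) (j : Fin M) : ‖unitRoot M j‖ = 1 := by
  rw [unitRoot, norm_pow, norm_exp_two_pi_I_div, one_pow]

theorem unitRoot_ne_zero (M : ℕ) (j : Fin M) : unitRoot M j ≠ 0 := by
  rw [← norm_ne_zero_iff, norm_unitRoot]
  exact one_ne_zero

theorem conj_eq_inv_of_norm_eq_one {z : ℂ} (hz : ‖z‖ = 1) : (starRingEnd ℂ) z = z⁻¹ := by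
  rw [Complex.inv_def, Complex.normSq_eq_norm_sq, hz]
  simp

theorem sum_unitRoot_zpow {M : ℕ} (hM : M ≠ 0) (k : ℤ) :
    ∑ j : Fin M, unitRoot M j ^ k = if (M : ℤ) ∣ k then (M : ℂ) else 0 := by
  have hp := Complex.isPrimitiveRoot_exp M hM
  set w := Complex.exp (2 * Real.pi * Complex.I / M) with hw
  have h1 : ∑ j : Fin M, unitRoot M j ^ k = ∑ j ∈ Finset.range M, (w ^ k) ^ j := by
    rw [← Fin.sum_univ_eq_sum_range fun j => (w ^ k) ^ j]
    refine Finset.sum_congr rfl fun j _ => ?_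
    rw [unitRoot, ← hw, ← zpow_natCast, ← zpow_natCast, ← zpow_mul, ← zpow_mul, mul_comm]
  rw [h1]
  split_ifs with h
  · simp [(hp.zpow_eq_one_iff_dvd k).2 h]
  · have h2 : w ^ k ≠ 1 := fun h' => h ((hp.zpow_eq_one_iff_dvd k).1 h')
    rw [geom_sum_eq h2, ← zpow_natCast, ← zpow_mul, mul_comm, zpow_mul, zpow_natCast, hp.pow_eq_one]
    simp

/-- Discrete Fourier inversion: exponents below `R ≤ M` differ by less than `M`, so there is no
aliasing. -/
theorem sum_unitRoot_mul_zpow_neg {R M : ℕ} (hRM : R ≤ M) (c : ℕ → ℂ) {l : ℕ} (hl : l < R) :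
    ∑ j : Fin M, (∑ k ∈ Finset.range R, c k * unitRoot M j ^ k) * unitRoot M j ^ (-(l : ℤ)) =
      M * c l := by
  have hM : M ≠ 0 := by omega
  have h1 (k : ℕ) (hk : k ∈ Finset.range R) :
      ∑ j : Fin M, c k * unitRoot M j ^ k * unitRoot M j ^ (-(l : ℤ)) =
        if k = l then (M : ℂ) * c l else 0 := by
    have h2 (j : Fin M) : c k * unitRoot M j ^ k * unitRoot M j ^ (-(l : ℤ)) =
        c k * unitRoot M j ^ ((k : ℤ) - l) := by
      rw [sub_eq_add_neg, zpow_add₀ (unitRoot_ne_zero M j), zpow_natCast, mul_assoc]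
    simp_rw [h2, ← Finset.mul_sum, sum_unitRoot_zpow hM]
    rw [Finset.mem_range] at hk
    have h3 : (M : ℤ) ∣ (k : ℤ) - l ↔ k = l := by
      constructor
      · intro h
        have := Int.eq_zero_of_abs_lt_dvd h (by rw [abs_lt]; omega)
        omega
      · rintro rfl
        simp
    by_cases h : k = l
    · simp [h, mul_comm]
    · simp [h3, h]
  simp_rw [Finset.sum_mul]
  rw [Finset.sum_comm, Finset.sum_congr rfl h1]
  simp [hl]

theorem norm_coeff_le_mean {R M : ℕ} (hRM : R ≤ M) (c : ℕ → ℂ) {l : ℕ} (hl : l < R) :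
    ‖c l‖ ≤ (M : ℝ)⁻¹ * ∑ j : Fin M, ‖∑ k ∈ Finset.range R, c k * unitRoot M j ^ k‖ := by
  have hM : (0 : ℝ) < M := by
    have : 0 < M := by omega
    exact_mod_cast this
  rw [inv_mul_eq_div, le_div_iff₀ hM]
  calc ‖c l‖ * M = ‖(M : ℂ) * c l‖ := by rw [norm_mul, Complex.norm_natCast, mul_comm]
    _ ≤ _ := by
      rw [← sum_unitRoot_mul_zpow_neg hRM c hl]
      refine (norm_sum_le _ _).trans (Finset.sum_le_sum fun j _ => ?_)
      rw [norm_mul, norm_zpow, norm_unitRoot, one_zpow, mul_one]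

theorem mean_norm_sq_eq {R M : ℕ} (hM : M ≠ 0) (hRM : R ≤ M) (c : ℕ → ℂ) :
    (M : ℝ)⁻¹ * ∑ j : Fin M, ‖∑ k ∈ Finset.range R, c k * unitRoot M j ^ k‖ ^ 2 =
      ∑ k ∈ Finset.range R, ‖c k‖ ^ 2 := by
  have hM' : (M : ℂ) ≠ 0 := by exact_mod_cast hM
  have key : ∑ j : Fin M, ((‖∑ k ∈ Finset.range R, c k * unitRoot M j ^ k‖ ^ 2 : ℝ) : ℂ) =
      M * ∑ k ∈ Finset.range R, ((‖c k‖ ^ 2 : ℝ) : ℂ) := by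
    have h1 (j : Fin M) : ((‖∑ k ∈ Finset.range R, c k * unitRoot M j ^ k‖ ^ 2 : ℝ) : ℂ) =
        ∑ l ∈ Finset.range R, (starRingEnd ℂ) (c l) *
          ((∑ k ∈ Finset.range R, c k * unitRoot M j ^ k) * unitRoot M j ^ (-(l : ℤ))) := by
      rw [← Complex.normSq_eq_norm_sq, ← Complex.mul_conj, map_sum, Finset.mul_sum]
      refine Finset.sum_congr rfl fun l _ => ?_
      rw [map_mul, map_pow, conj_eq_inv_of_norm_eq_one (norm_unitRoot M j), zpow_neg, zpow_natCast,
        inv_pow]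
      ring
    simp_rw [h1]
    rw [Finset.sum_comm, Finset.mul_sum]
    refine Finset.sum_congr rfl fun l hl => ?_
    rw [← Finset.mul_sum, sum_unitRoot_mul_zpow_neg hRM c (Finset.mem_range.1 hl),
      ← Complex.normSq_eq_norm_sq, ← Complex.mul_conj]
    ring
  have key' : ∑ j : Fin M, ‖∑ k ∈ Finset.range R, c k * unitRoot M j ^ k‖ ^ 2 =
      M * ∑ k ∈ Finset.range R, ‖c k‖ ^ 2 := by
    exact_mod_cast key
  rw [key', inv_mul_cancel_left₀ (by exact_mod_cast hM)]

theorem norm_pow_sub_pow_le_of_norm_eq_one {z w : ℂ} (hz : ‖z‖ = 1) (hw : ‖w‖ = 1) (k : ℕ) :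
    ‖z ^ k - w ^ k‖ ≤ k * ‖z - w‖ := by
  induction k with
  | zero => simp
  | succ k ih =>
    have : z ^ (k + 1) - w ^ (k + 1) = z ^ k * (z - w) + (z ^ k - w ^ k) * w := by ring
    rw [this]
    refine (norm_add_le _ _).trans ?_
    rw [norm_mul, norm_mul, norm_pow, hz, hw, one_pow]
    push_cast
    linarith

theorem unitRoot_mul_eq {M q : ℕ} (hM : M ≠ 0) (hq : q ≠ 0) (i : Fin M) (s : Fin q) :
    unitRoot (M * q) (finProdFinEquiv (i, s)) =
      unitRoot M i * Complex.exp (Complex.I * ((2 * Real.pi * s / (M * q) : ℝ) : ℂ)) := by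
  have hM' : (M : ℂ) ≠ 0 := by exact_mod_cast hM
  have hq' : (q : ℂ) ≠ 0 := by exact_mod_cast hq
  rw [unitRoot, unitRoot, ← Complex.exp_nat_mul, ← Complex.exp_nat_mul, ← Complex.exp_add]
  congr 1
  simp only [finProdFinEquiv_apply_val]
  push_cast
  field_simp
  ring

theorem norm_unitRoot_mul_sub_le {M q : ℕ} (hM : M ≠ 0) (hq : q ≠ 0) (i : Fin M) (s : Fin q) :
    ‖unitRoot (M * q) (finProdFinEquiv (i, s)) - unitRoot M i‖ ≤ 2 * Real.pi / M := by
  have hM' : (0 : ℝ) < M := by exact_mod_cast Nat.pos_of_ne_zero hM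
  have hq' : (0 : ℝ) < q := by exact_mod_cast Nat.pos_of_ne_zero hq
  rw [unitRoot_mul_eq hM hq, ← mul_sub_one, norm_mul, norm_unitRoot, one_mul]
  refine (Real.norm_exp_I_mul_ofReal_sub_one_le).trans ?_
  rw [Real.norm_of_nonneg (by positivity), div_le_div_iff₀ (by positivity) hM']
  have : (s : ℝ) ≤ q := by exact_mod_cast s.2.le
  have h2 : 2 * Real.pi * M * s ≤ 2 * Real.pi * M * q := by gcongr
  linarith

/-- Refining the grid increases the mean of the modulus of a polynomial at most by a factor close
to `1`. -/
theorem mean_refine_le {m M q : ℕ} (hM : m < M) (hq : q ≠ 0) (a : ℕ → ℂ) :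
    ((M * q : ℕ) : ℝ)⁻¹ *
        ∑ j : Fin (M * q), ‖∑ k ∈ Finset.range (m + 1), a k * unitRoot (M * q) j ^ k‖ ≤
      (1 + 2 * Real.pi * (m + 1) * m / M) *
        ((M : ℝ)⁻¹ * ∑ j : Fin M, ‖∑ k ∈ Finset.range (m + 1), a k * unitRoot M j ^ k‖) := by
  have hM0 : M ≠ 0 := by omega
  have hM' : (0 : ℝ) < M := by exact_mod_cast Nat.pos_of_ne_zero hM0
  have hq' : (0 : ℝ) < q := by exact_mod_cast Nat.pos_of_ne_zero hq
  set E := (M : ℝ)⁻¹ * ∑ j : Fin M, ‖∑ k ∈ Finset.range (m + 1), a k * unitRoot M j ^ k‖ with hE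
  have hE0 : 0 ≤ E := by positivity
  have h1 (i : Fin M) (s : Fin q) :
      ‖∑ k ∈ Finset.range (m + 1), a k * unitRoot (M * q) (finProdFinEquiv (i, s)) ^ k‖ ≤
        ‖∑ k ∈ Finset.range (m + 1), a k * unitRoot M i ^ k‖ +
          (m + 1) * (E * (m * (2 * Real.pi / M))) := by
    refine (norm_le_norm_add_norm_sub' _
      (∑ k ∈ Finset.range (m + 1), a k * unitRoot M i ^ k)).trans ?_
    gcongr
    rw [← Finset.sum_sub_distrib]
    -- The k-th term moves by at most |a_k| k (2π / M) when the fine grid point is replaced by the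
    -- nearby coarse one, and |a_k| is itself at most the coarse mean `E`. This makes the error
    -- relative instead of absolute.
    refine (norm_sum_le_of_le _ (n := fun _ => E * (m * (2 * Real.pi / M))) fun k hk => ?_).trans
      (by simp)
    rw [← mul_sub, norm_mul]
    have hk' := Finset.mem_range.1 hk
    gcongr
    · exact norm_coeff_le_mean (Nat.succ_le_of_lt hM) a hk'
    · refine (norm_pow_sub_pow_le_of_norm_eq_one (norm_unitRoot _ _) (norm_unitRoot _ _) k).trans ?_
      have : (k : ℝ) ≤ m := by exact_mod_cast Nat.lt_succ_iff.1 hk'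
      gcongr
      exact norm_unitRoot_mul_sub_le hM0 hq i s
  rw [← finProdFinEquiv.sum_comp, Fintype.sum_prod_type]
  calc _ ≤ ((M * q : ℕ) : ℝ)⁻¹ * ∑ i : Fin M, ∑ _s : Fin q,
        (‖∑ k ∈ Finset.range (m + 1), a k * unitRoot M i ^ k‖ +
          (m + 1) * (E * (m * (2 * Real.pi / M)))) := by
        gcongr with i _ s _
        exact h1 i s
    _ = E + (m + 1) * (E * (m * (2 * Real.pi / M))) := by
        simp only [Finset.sum_const, Finset.card_univ, Fintype.card_fin, nsmul_eq_mul,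
          ← Finset.mul_sum, Finset.sum_add_distrib]
        rw [hE]
        push_cast
        field_simp
    _ = _ := by ring

/-! ### Carleman's inequality for polynomials, on a grid -/

section Carleman

open PowerSeries Filter

/-- The difference of squares factors as (|x| - |y|)(|x| + |y|): the first factor is at most the
tail, the second at most twice the full sum of moduli. -/
theorem norm_sum_range_sq_le {u : PowerSeries ℂ} (hu : Summable fun k => ‖coeff k u‖) {z : ℂ}
    (hz : ‖z‖ = 1) (T : ℕ) :
    ‖∑ k ∈ Finset.range T, coeff k u * z ^ k‖ ^ 2 ≤ ‖u.sumAt z‖ ^ 2 +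
      2 * (∑' k, ‖coeff k u‖) *
        (∑' k, ‖coeff k u‖ - ∑ k ∈ Finset.range T, ‖coeff k u‖) := by
  have hn (k : ℕ) : ‖coeff k u * z ^ k‖ = ‖coeff k u‖ := by simp [hz]
  have hsum : Summable fun k => ‖coeff k u * z ^ k‖ := by simpa only [hn] using hu
  have h1 : ‖∑ k ∈ Finset.range T, coeff k u * z ^ k‖ ≤ ∑' k, ‖coeff k u‖ := by
    refine (norm_sum_le _ _).trans ?_
    simp_rw [hn]
    exact hu.sum_le_tsum _ fun _ _ => norm_nonneg _
  have h2 : ‖u.sumAt z‖ ≤ ∑' k, ‖coeff k u‖ := by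
    refine (norm_tsum_le_tsum_norm hsum).trans ?_
    simp_rw [hn]
    exact le_rfl
  have h3 : ‖∑ k ∈ Finset.range T, coeff k u * z ^ k - u.sumAt z‖ ≤
      ∑' k, ‖coeff k u‖ - ∑ k ∈ Finset.range T, ‖coeff k u‖ := by
    have h4 := hsum.of_norm.sum_add_tsum_nat_add T
    have h5 := hu.sum_add_tsum_nat_add T
    rw [sumAt, ← h4, sub_add_cancel_left, norm_neg, ← h5, add_sub_cancel_left]
    have h6 : Summable fun k => ‖coeff (k + T) u * z ^ (k + T)‖ :=
      (summable_nat_add_iff (f := fun k => ‖coeff k u * z ^ k‖) T).2 hsum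
    refine (norm_tsum_le_tsum_norm h6).trans (le_of_eq (tsum_congr fun k => hn (k + T)))
  generalize ∑' k, ‖coeff k u‖ - ∑ k ∈ Finset.range T, ‖coeff k u‖ = t at *
  generalize ∑' k, ‖coeff k u‖ = S at *
  generalize ∑ k ∈ Finset.range T, coeff k u * z ^ k = x at *
  generalize u.sumAt z = y at *
  have h7 : ‖x‖ ≤ ‖y‖ + t := (norm_le_norm_add_norm_sub' x y).trans (by linarith)
  have h8 : 0 ≤ t := (norm_nonneg _).trans h3
  nlinarith [mul_nonneg (sub_nonneg.2 h7) (add_nonneg (norm_nonneg x) (norm_nonneg y)),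
    mul_nonneg h8 (sub_nonneg.2 (add_le_add h1 h2))]

/-- This is ‖u‖₂² = ‖f‖₁ on grids. Parseval needs a polynomial, so `u` is truncated at T, on a
refinement of the given grid with at least T points. There |u|² = |f| up to the tail, and
`mean_refine_le` returns to the grid of size `M`. The tail vanishes as T grows. -/
theorem sum_norm_sq_coeff_le {m M : ℕ} (hM : m < M) (a : ℕ → ℂ) {f : Polynomial ℂ}
    (hf : ∀ z, f.eval z = ∑ k ∈ Finset.range (m + 1), a k * z ^ k) {u : PowerSeries ℂ}
    (hu : u.AbsSummable) (huf : ∀ z : ℂ, ‖z‖ = 1 → ‖u.sumAt z‖ ^ 2 = ‖f.eval z‖) (R : ℕ) :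
    ∑ k ∈ Finset.range R, ‖coeff k u‖ ^ 2 ≤ (1 + 2 * Real.pi * (m + 1) * m / M) *
        ((M : ℝ)⁻¹ * ∑ j : Fin M, ‖∑ k ∈ Finset.range (m + 1), a k * unitRoot M j ^ k‖) := by
  set B := (1 + 2 * Real.pi * (m + 1) * m / M) *
        ((M : ℝ)⁻¹ * ∑ j : Fin M, ‖∑ k ∈ Finset.range (m + 1), a k * unitRoot M j ^ k‖) with hB
  set S := ∑' k, ‖coeff k u‖ with hS
  set t : ℕ → ℝ := fun T => S - ∑ k ∈ Finset.range T, ‖coeff k u‖ with ht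
  have ht0 : Tendsto t atTop (nhds 0) := by
    have := hu.hasSum.tendsto_sum_nat.const_sub S
    rwa [sub_self] at this
  have hlim : Tendsto (fun T => B + 2 * S * t T) atTop (nhds B) := by
    simpa using (ht0.const_mul (2 * S)).const_add B
  refine ge_of_tendsto hlim ?_
  filter_upwards [eventually_ge_atTop R] with T hT
  have hM0 : M ≠ 0 := by omega
  -- The refinement factor is T + 1 and not T so that it never vanishes.
  have hQ : T ≤ M * (T + 1) := by nlinarith [Nat.pos_of_ne_zero hM0]
  have hQ0 : M * (T + 1) ≠ 0 := by positivity
  have htrunc (z : ℂ) (hz : ‖z‖ = 1) :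
      ‖∑ k ∈ Finset.range T, coeff k u * z ^ k‖ ^ 2 ≤ ‖f.eval z‖ + 2 * S * t T := by
    rw [← huf z hz]
    exact norm_sum_range_sq_le hu hz T
  calc ∑ k ∈ Finset.range R, ‖coeff k u‖ ^ 2 ≤ ∑ k ∈ Finset.range T, ‖coeff k u‖ ^ 2 :=
        Finset.sum_le_sum_of_subset_of_nonneg (by simpa using hT) fun _ _ _ => sq_nonneg _
    _ = ((M * (T + 1) : ℕ) : ℝ)⁻¹ * ∑ j : Fin (M * (T + 1)),
          ‖∑ k ∈ Finset.range T, coeff k u * unitRoot (M * (T + 1)) j ^ k‖ ^ 2 :=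
        (mean_norm_sq_eq hQ0 hQ _).symm
    _ ≤ ((M * (T + 1) : ℕ) : ℝ)⁻¹ * ∑ j : Fin (M * (T + 1)),
          (‖f.eval (unitRoot (M * (T + 1)) j)‖ + 2 * S * t T) := by
        gcongr with j _
        exact htrunc _ (norm_unitRoot _ _)
    _ = ((M * (T + 1) : ℕ) : ℝ)⁻¹ * ∑ j : Fin (M * (T + 1)),
          ‖f.eval (unitRoot (M * (T + 1)) j)‖ + 2 * S * t T := by
        rw [Finset.sum_add_distrib, mul_add]
        congr 1
        simp only [Finset.sum_const, Finset.card_univ, Fintype.card_fin, nsmul_eq_mul]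
        rw [inv_mul_cancel_left₀ (by exact_mod_cast hQ0)]
    _ ≤ B + 2 * S * t T := by
        gcongr
        simp_rw [hf]
        exact mean_refine_le hM (Nat.succ_ne_zero T) a

theorem norm_sq_sum_antidiagonal_le (u v : ℕ → ℂ) (k : ℕ) :
    ‖∑ p ∈ Finset.HasAntidiagonal.antidiagonal k, u p.1 * v p.2‖ ^ 2 ≤
      (k + 1) * ∑ p ∈ Finset.HasAntidiagonal.antidiagonal k, ‖u p.1‖ ^ 2 * ‖v p.2‖ ^ 2 := by
  calc _ ≤ (∑ p ∈ Finset.HasAntidiagonal.antidiagonal k, ‖u p.1‖ * ‖v p.2‖) ^ 2 := by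
        gcongr
        exact (norm_sum_le _ _).trans (by simp)
    _ ≤ _ := by
        refine sq_sum_le_card_mul_sum_sq.trans ?_
        simp [mul_pow]

theorem sum_norm_sq_div_two_pow_le_of_convolution {n : ℕ} {a u v : ℕ → ℂ} {B : ℝ}
    (hU : ∀ R, ∑ k ∈ Finset.range R, ‖u k‖ ^ 2 ≤ B) (hV : ∀ R, ∑ k ∈ Finset.range R, ‖v k‖ ^ 2 ≤ B)
    (ha : ∀ k ∈ Finset.range n,
      a k = ∑ p ∈ Finset.HasAntidiagonal.antidiagonal k, u p.1 * v p.2) :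
    ∑ k ∈ Finset.range n, ‖a k‖ ^ 2 / 2 ^ k ≤ B ^ 2 := by
  have hB0 : 0 ≤ B := by simpa using hU 0
  have hUs := summable_of_sum_range_le (fun k => sq_nonneg ‖u k‖) hU
  have hVs := summable_of_sum_range_le (fun k => sq_nonneg ‖v k‖) hV
  have hUn : Summable fun k => ‖‖u k‖ ^ 2‖ := hUs.norm
  have hVn : Summable fun k => ‖‖v k‖ ^ 2‖ := hVs.norm
  have hprod := (summable_norm_sum_mul_antidiagonal_of_summable_norm hUn hVn).of_norm
  calc ∑ k ∈ Finset.range n, ‖a k‖ ^ 2 / 2 ^ k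
      ≤ ∑ k ∈ Finset.range n, ∑ p ∈ Finset.HasAntidiagonal.antidiagonal k,
          ‖u p.1‖ ^ 2 * ‖v p.2‖ ^ 2 := by
        refine Finset.sum_le_sum fun k hk => ?_
        rw [div_le_iff₀ (by positivity), mul_comm, ha k hk]
        refine (norm_sq_sum_antidiagonal_le _ _ k).trans ?_
        gcongr
        -- The weight 2 ^ k absorbs the k + 1 terms of the convolution.
        exact_mod_cast Nat.lt_two_pow_self (n := k)
    _ ≤ ∑' k, ∑ p ∈ Finset.HasAntidiagonal.antidiagonal k, ‖u p.1‖ ^ 2 * ‖v p.2‖ ^ 2 :=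
        hprod.sum_le_tsum _ fun _ _ => Finset.sum_nonneg fun _ _ => by positivity
    _ = (∑' k, ‖u k‖ ^ 2) * ∑' k, ‖v k‖ ^ 2 :=
        (tsum_mul_tsum_eq_tsum_sum_antidiagonal_of_summable_norm hUn hVn).symm
    _ ≤ B * B := mul_le_mul (hUs.tsum_le_of_sum_range_le hU) (hVs.tsum_le_of_sum_range_le hV)
        (tsum_nonneg fun _ => sq_nonneg _) hB0
    _ = B ^ 2 := (sq B).symm

theorem HasBalancedFactorization.sum_coeff_le {m M : ℕ} (hM : m < M) (a : ℕ → ℂ) {f : Polynomial ℂ}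
    (hf : f = ∑ k ∈ Finset.range (m + 1), Polynomial.C (a k) * Polynomial.X ^ k)
    (h : HasBalancedFactorization f) :
    ∑ k ∈ Finset.range (m + 1), ‖a k‖ ^ 2 / 2 ^ k ≤ ((1 + 2 * Real.pi * (m + 1) * m / M) *
        ((M : ℝ)⁻¹ * ∑ j : Fin M,
          ‖∑ k ∈ Finset.range (m + 1), a k * unitRoot M j ^ k‖)) ^ 2 := by
  obtain ⟨u, v, hu, hv, huv, huvf⟩ := h
  have hev (z : ℂ) : f.eval z = ∑ k ∈ Finset.range (m + 1), a k * z ^ k := by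
    simp [hf, Polynomial.eval_finsetSum]
  have hU := sum_norm_sq_coeff_le hM a hev hu fun z hz => (huvf z hz).1
  have hV := sum_norm_sq_coeff_le hM a hev hv fun z hz => (huvf z hz).2
  refine sum_norm_sq_div_two_pow_le_of_convolution hU hV fun k hk => ?_
  rw [← coeff_mul, huv, Polynomial.coeff_coe, hf, Polynomial.finsetSum_coeff]
  simp only [Polynomial.coeff_C_mul_X_pow]
  rw [Finset.sum_ite_eq, if_pos hk]

/-- The inequality `∑ |a_k|² / 2 ^ k ≤ ‖f‖₁²` for polynomials `f(z) = ∑ a_k z ^ k`, up to a factor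
that tends to `1` as the grid gets finer. -/
theorem sum_norm_sq_div_two_pow_le {m M : ℕ} (hM : m < M) (a : ℕ → ℂ) :
    ∑ k ∈ Finset.range (m + 1), ‖a k‖ ^ 2 / 2 ^ k ≤ ((1 + 2 * Real.pi * (m + 1) * m / M) *
        ((M : ℝ)⁻¹ * ∑ j : Fin M,
          ‖∑ k ∈ Finset.range (m + 1), a k * unitRoot M j ^ k‖)) ^ 2 := by
  set f : Polynomial ℂ := ∑ k ∈ Finset.range (m + 1), Polynomial.C (a k) * Polynomial.X ^ k with hf
  -- Dilating f to f(r z) moves its roots off the unit circle unless |r| is the modulus of a root of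
  -- f. Finitely many real r, of either sign, are excluded; both sides are continuous in r, so r = 1
  -- follows by density.
  let s : Set ℝ := (fun c : ℂ => ‖c‖) '' (f.roots.toFinset : Set ℂ) ∪
    ((fun c : ℂ => -‖c‖) '' (f.roots.toFinset : Set ℂ) ∪ {0})
  have hs : s.Finite := ((Finset.finite_toSet _).image _).union
    (((Finset.finite_toSet _).image _).union (Set.finite_singleton 0))
  have hdense : Dense (sᶜ) := hs.countable.dense_compl ℝ
  let b : ℝ → ℕ → ℂ := fun r k => a k * (r : ℂ) ^ k
  have hclosed : IsClosed {r : ℝ | ∑ k ∈ Finset.range (m + 1), ‖b r k‖ ^ 2 / 2 ^ k ≤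
      ((1 + 2 * Real.pi * (m + 1) * m / M) * ((M : ℝ)⁻¹ * ∑ j : Fin M,
          ‖∑ k ∈ Finset.range (m + 1), b r k * unitRoot M j ^ k‖)) ^ 2} :=
    isClosed_le (by fun_prop) (by fun_prop)
  have hsub : sᶜ ⊆ {r : ℝ | ∑ k ∈ Finset.range (m + 1), ‖b r k‖ ^ 2 / 2 ^ k ≤
      ((1 + 2 * Real.pi * (m + 1) * m / M) * ((M : ℝ)⁻¹ * ∑ j : Fin M,
          ‖∑ k ∈ Finset.range (m + 1), b r k * unitRoot M j ^ k‖)) ^ 2} := by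
    intro r hr
    refine HasBalancedFactorization.sum_coeff_le hM (b r) rfl
      (HasBalancedFactorization.of_forall_root fun c hc hc1 => hr ?_)
    have hg : (∑ k ∈ Finset.range (m + 1), Polynomial.C (b r k) * Polynomial.X ^ k) =
        f.comp (Polynomial.C (r : ℂ) * Polynomial.X) := by
      simp [hf, b, Polynomial.sum_comp, mul_pow, mul_assoc]
    rw [hg, Polynomial.mem_roots', Polynomial.IsRoot, Polynomial.eval_comp] at hc
    obtain ⟨hc0, hc2⟩ := hc
    have hroot : (r : ℂ) * c ∈ f.roots := by
      rw [Polynomial.mem_roots']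
      refine ⟨?_, by simpa using hc2⟩
      intro h0
      rw [h0] at hc0
      simp at hc0
    have hnorm : ‖(r : ℂ) * c‖ = |r| := by simp [hc1]
    rcases abs_choice r with h | h
    · exact Or.inl ⟨(r : ℂ) * c, by simpa using hroot, by simp only [hnorm, h]⟩
    · exact Or.inr (Or.inl ⟨(r : ℂ) * c, by simpa using hroot, by simp only [hnorm, h, neg_neg]⟩)
  have h1 := hclosed.closure_subset_iff.2 hsub (hdense 1)
  simpa [b] using h1

end Carleman

/-! ### Hypercontractivity on a grid of the torus -/

/-- Minkowski's inequality in a weighted ℓ² space, obtained by expanding the square and applying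
Cauchy–Schwarz to each pair. -/
theorem sum_mul_sum_sq_le_sum_sq {ι κ : Type*} [Fintype ι] [Fintype κ] {w : ι → ℝ} (hw : ∀ k, 0 ≤ w k)
    {x : ι → κ → ℝ} {s : κ → ℝ} (hs : ∀ j, 0 ≤ s j) (h : ∀ j, ∑ k, w k * x k j ^ 2 ≤ s j ^ 2) :
    ∑ k, w k * (∑ j, x k j) ^ 2 ≤ (∑ j, s j) ^ 2 := by
  have h1 (i j : κ) : ∑ k, w k * (x k i * x k j) ≤ s i * s j := by
    refine abs_le_of_sq_le_sq' ?_ (mul_nonneg (hs i) (hs j)) |>.2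
    calc (∑ k, w k * (x k i * x k j)) ^ 2 ≤ (∑ k, w k * x k i ^ 2) * ∑ k, w k * x k j ^ 2 :=
          Finset.sum_sq_le_sum_mul_sum_of_sq_le_mul _
            (fun k _ => mul_nonneg (hw k) (sq_nonneg _))
            (fun k _ => mul_nonneg (hw k) (sq_nonneg _)) fun k _ => le_of_eq (by ring)
      _ ≤ s i ^ 2 * s j ^ 2 := by
          gcongr
          · exact Finset.sum_nonneg fun k _ => mul_nonneg (hw k) (sq_nonneg _)
          · exact h i
          · exact h j
      _ = (s i * s j) ^ 2 := by ring
  calc ∑ k, w k * (∑ j, x k j) ^ 2 = ∑ i, ∑ j, ∑ k, w k * (x k i * x k j) := by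
        simp_rw [sq, Finset.sum_mul_sum, Finset.mul_sum]
        rw [Finset.sum_comm]
        exact Finset.sum_congr rfl fun i _ => Finset.sum_comm
    _ ≤ ∑ i, ∑ j, s i * s j := by
        gcongr with i _ j _
        exact h1 i j
    _ = (∑ j, s j) ^ 2 := by rw [sq, Finset.sum_mul_sum]

theorem sum_pi_fin_succ {n : ℕ} {κ β : Type*} [Fintype κ] [AddCommMonoid β]
    (F : (Fin (n + 1) → κ) → β) :
    ∑ α, F α = ∑ k : κ, ∑ β : Fin n → κ, F (Fin.cons k β) := by
  rw [← (Fin.consEquiv fun _ => κ).sum_comp, Fintype.sum_prod_type]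
  rfl

/-- For polynomials of degree at most `m` in each of `n` variables, the inequality
`∑ |a_α|² / 2 ^ |α| ≤ ‖f‖₁²`, up to a factor that tends to `1` as the grid gets finer. -/
theorem sum_norm_sq_div_two_pow_sum_le {m M : ℕ} (hM : m < M) (n : ℕ)
    (a : (Fin n → Fin (m + 1)) → ℂ) :
    ∑ α, ‖a α‖ ^ 2 / 2 ^ (∑ i, (α i : ℕ)) ≤ ((1 + 2 * Real.pi * (m + 1) * m / M) ^ n *
        ((M : ℝ)⁻¹ ^ n * ∑ j : Fin n → Fin M,
          ‖∑ α, a α * ∏ i, unitRoot M (j i) ^ (α i : ℕ)‖)) ^ 2 := by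
  induction n with
  | zero => simp
  | succ n ih =>
    set C : ℝ := 1 + 2 * Real.pi * (m + 1) * m / M with hC
    have hC0 : 0 ≤ C := by positivity
    set D : ℝ := C ^ n * (M : ℝ)⁻¹ ^ n with hD
    have hD0 : 0 ≤ D := by positivity
    -- Coefficients with respect to the first variable, the others being fixed at a grid point. The
    -- induction hypothesis treats the other variables for each k, `h1` is the one-variable
    -- inequality, and Minkowski in `h2` interchanges the sum over grid points with the weighted ℓ²
    -- norm in k.
    let g (k : Fin (m + 1)) (j : Fin n → Fin M) : ℂ :=
      ∑ β, a (Fin.cons k β) * ∏ i, unitRoot M (j i) ^ (β i : ℕ)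
    have h1 (j : Fin n → Fin M) : ∑ k : Fin (m + 1), (1 / 2 ^ (k : ℕ) : ℝ) * ‖g k j‖ ^ 2 ≤
        (C * ((M : ℝ)⁻¹ * ∑ i : Fin M, ‖∑ k, g k j * unitRoot M i ^ (k : ℕ)‖)) ^ 2 := by
      have := sum_norm_sq_div_two_pow_le hM fun k => if h : k < m + 1 then g ⟨k, h⟩ j else 0
      simp only [Finset.sum_range, Fin.is_lt, dite_true, Fin.eta] at this
      simpa only [one_div_mul_eq_div] using this
    have h2 := sum_mul_sum_sq_le_sum_sq (fun k : Fin (m + 1) => by positivity)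
      (fun j : Fin n → Fin M => by positivity) h1
    calc ∑ α : Fin (n + 1) → Fin (m + 1), ‖a α‖ ^ 2 / 2 ^ (∑ i, (α i : ℕ))
        = ∑ k : Fin (m + 1), (1 / 2 ^ (k : ℕ) : ℝ) *
            ∑ β : Fin n → Fin (m + 1), ‖a (Fin.cons k β)‖ ^ 2 / 2 ^ (∑ i, (β i : ℕ)) := by
          rw [sum_pi_fin_succ]
          refine Finset.sum_congr rfl fun k _ => ?_
          rw [Finset.mul_sum]
          refine Finset.sum_congr rfl fun β _ => ?_
          rw [Fin.sum_univ_succ]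
          simp only [Fin.cons_zero, Fin.cons_succ]
          rw [pow_add]
          field_simp
      _ ≤ ∑ k : Fin (m + 1), (1 / 2 ^ (k : ℕ) : ℝ) * (D * ∑ j, ‖g k j‖) ^ 2 := by
          gcongr with k _
          have := ih fun β => a (Fin.cons k β)
          rwa [← mul_assoc] at this
      _ = D ^ 2 * ∑ k : Fin (m + 1), (1 / 2 ^ (k : ℕ) : ℝ) * (∑ j, ‖g k j‖) ^ 2 := by
          rw [Finset.mul_sum]
          exact Finset.sum_congr rfl fun k _ => by ring
      _ ≤ D ^ 2 * (∑ j, C * ((M : ℝ)⁻¹ *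
            ∑ i : Fin M, ‖∑ k, g k j * unitRoot M i ^ (k : ℕ)‖)) ^ 2 := by gcongr
      _ = _ := by
          rw [← mul_pow]
          congr 1
          rw [sum_pi_fin_succ, Finset.sum_comm, ← Finset.mul_sum, ← Finset.mul_sum, hD, pow_succ,
            pow_succ]
          have h3 (j : Fin n → Fin M) (i : Fin M) : ∑ k, g k j * unitRoot M i ^ (k : ℕ) =
              ∑ α : Fin (n + 1) → Fin (m + 1), a α *
                ∏ l, unitRoot M ((Fin.cons i j : Fin (n + 1) → Fin M) l) ^ (α l : ℕ) := by
            rw [sum_pi_fin_succ]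
            refine Finset.sum_congr rfl fun k _ => ?_
            rw [Finset.sum_mul]
            refine Finset.sum_congr rfl fun β _ => ?_
            rw [Fin.prod_univ_succ]
            simp only [Fin.cons_zero, Fin.cons_succ]
            ring
          simp_rw [h3]
          ring

/-! ### Frequencies and characters -/

/-- The multi-indices of order at most `m`, as a finset. -/
def degLE (m n : ℕ) : Finset (Fin n → ℕ) :=
  (Fintype.piFinset fun _ => Finset.range (m + 1)).filter fun α => ∑ j, α j ≤ m

theorem mem_degLE {m n : ℕ} {α : Fin n → ℕ} : α ∈ degLE m n ↔ ∑ j, α j ≤ m := by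
  simp only [degLE, Finset.mem_filter, Fintype.mem_piFinset, Finset.mem_range, and_iff_right_iff_imp]
  intro h j
  exact Nat.lt_succ_of_le ((Finset.single_le_sum (fun _ _ => Nat.zero_le _) (Finset.mem_univ j)).trans h)

theorem card_degLE (m n : ℕ) :
    (degLE m n).card = ∑ k ∈ Finset.range (m + 1), (n + k - 1).choose k := by
  rw [Finset.card_eq_sum_card_fiberwise (f := fun α => ∑ j, α j) (t := Finset.range (m + 1))
    fun α hα => by simpa [Nat.lt_succ_iff] using mem_degLE.1 hα]
  refine Finset.sum_congr rfl fun k hk => ?_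
  have h := Finset.card_finsuppAntidiag_nat_eq_choose (s := (Finset.univ : Finset (Fin n))) k
  rw [Finset.card_univ, Fintype.card_fin] at h
  rw [← h]
  refine (Finset.card_equiv Finsupp.equivFunOnFinite fun α => ?_).symm
  have hk' := Finset.mem_range.1 hk
  simp only [Finset.mem_finsuppAntidiag, Finset.mem_filter, mem_degLE,
    Finsupp.equivFunOnFinite_apply, Finset.subset_univ, and_true]
  change Finset.univ.sum (fun x => α x) = k ↔ _
  omega

/-- The frequency `∑ γ_j log p_j`. -/
noncomputable def primeFreq {n : ℕ} (γ : Fin n → ℤ) : ℝ :=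
  ∑ j, γ j * Real.log (Nat.nth Nat.Prime j)

theorem primeFreq_add {n : ℕ} (γ δ : Fin n → ℤ) :
    primeFreq (γ + δ) = primeFreq γ + primeFreq δ := by
  simp [primeFreq, add_mul, Finset.sum_add_distrib]

theorem primeFreq_neg {n : ℕ} (γ : Fin n → ℤ) : primeFreq (-γ) = -primeFreq γ := by
  simp [primeFreq]

theorem nth_prime_prime (j : ℕ) : (Nat.nth Nat.Prime j).Prime :=
  Nat.nth_mem_of_infinite Nat.infinite_setOfPred_prime j

theorem primePow_pos {n : ℕ} (α : Fin n → ℕ) : 0 < primePow α :=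
  Finset.prod_pos fun j _ => pow_pos (nth_prime_prime j).pos _

/-- The exponents of a multi-index, as integers. -/
def intExp {n : ℕ} (α : Fin n → ℕ) : Fin n → ℤ := fun j => α j

theorem intExp_injective {n : ℕ} : Function.Injective (intExp (n := n)) := fun α β h =>
  funext fun j => by simpa [intExp] using congrFun h j

theorem log_primePow {n : ℕ} (α : Fin n → ℕ) : Real.log (primePow α) = primeFreq (intExp α) := by
  rw [primePow, Nat.cast_prod, Real.log_prod]
  · simp [primeFreq, intExp]
  · intro j _
    exact_mod_cast (pow_pos (nth_prime_prime j).pos _).ne'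

theorem primePow_factorization {n : ℕ} (α : Fin n → ℕ) (i : Fin n) :
    (primePow α).factorization (Nat.nth Nat.Prime i) = α i := by
  have h : ∀ j ∈ Finset.univ, Nat.nth Nat.Prime (j : Fin n) ^ α j ≠ 0 := fun j _ =>
    (pow_pos (nth_prime_prime j).pos _).ne'
  rw [primePow, Nat.factorization_prod h,
    Finset.sum_apply', Finset.sum_eq_single i]
  · rw [(nth_prime_prime i).factorization_pow]
    simp
  · intro j _ hj
    rw [(nth_prime_prime j).factorization_pow, Finsupp.single_apply, if_neg]
    intro h
    exact hj (Fin.ext (Nat.nth_injective Nat.infinite_setOfPred_prime h))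
  · simp

theorem primePow_injective {n : ℕ} : Function.Injective (primePow (n := n)) := fun α β h =>
  funext fun i => by rw [← primePow_factorization α, h, primePow_factorization]

/-- Splitting γ into positive and negative parts turns a vanishing frequency into two equal products
of prime powers, contradicting unique factorization. -/
theorem primeFreq_ne_zero {n : ℕ} {γ : Fin n → ℤ} (hγ : γ ≠ 0) : primeFreq γ ≠ 0 := by
  intro h
  apply hγ
  set α : Fin n → ℕ := fun j => (γ j).toNat with hα
  set β : Fin n → ℕ := fun j => (-γ j).toNat with hβ
  have h1 : intExp α = γ + intExp β := by
    ext j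
    simp only [intExp, hα, hβ, Pi.add_apply]
    omega
  have h2 : Real.log (primePow α) = Real.log (primePow β) := by
    rw [log_primePow, log_primePow, h1, primeFreq_add, h, zero_add]
  have h3 : (primePow α : ℝ) = primePow β :=
    Real.log_injOn_pos (Set.mem_Ioi.2 (by exact_mod_cast primePow_pos α))
      (Set.mem_Ioi.2 (by exact_mod_cast primePow_pos β)) h2
  have h4 : α = β := primePow_injective (by exact_mod_cast h3)
  rw [h4] at h1
  simpa using h1

/-- The character `t ↦ ∏ p_j ^ (-i γ_j t)` of the real line. -/
noncomputable def primeChar {n : ℕ} (γ : Fin n → ℤ) (t : ℝ) : ℂ :=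
  Complex.exp (-(primeFreq γ : ℂ) * (t * Complex.I))

theorem primeChar_add {n : ℕ} (γ δ : Fin n → ℤ) (t : ℝ) :
    primeChar (γ + δ) t = primeChar γ t * primeChar δ t := by
  rw [primeChar, primeFreq_add, primeChar, primeChar, ← Complex.exp_add]
  push_cast
  ring_nf

theorem primeChar_zero {n : ℕ} (t : ℝ) : primeChar (0 : Fin n → ℤ) t = 1 := by
  simp [primeChar, primeFreq]

theorem primeChar_neg {n : ℕ} (γ : Fin n → ℤ) (t : ℝ) : primeChar (-γ) t = (primeChar γ t)⁻¹ := by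
  rw [primeChar, primeFreq_neg, primeChar, ← Complex.exp_neg]
  push_cast
  ring_nf

theorem primeChar_add_time {n : ℕ} (γ : Fin n → ℤ) (s t : ℝ) :
    primeChar γ (s + t) = primeChar γ s * primeChar γ t := by
  rw [primeChar, primeChar, primeChar, ← Complex.exp_add]
  push_cast
  ring_nf

theorem primeChar_neg_time {n : ℕ} (γ : Fin n → ℤ) (t : ℝ) :
    primeChar γ (-t) = primeChar (-γ) t := by
  rw [primeChar, primeChar, primeFreq_neg]
  push_cast
  ring_nf

theorem norm_primeChar {n : ℕ} (γ : Fin n → ℤ) (t : ℝ) : ‖primeChar γ t‖ = 1 := by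
  simp [primeChar, Complex.norm_exp]

theorem conj_primeChar {n : ℕ} (γ : Fin n → ℤ) (t : ℝ) :
    (starRingEnd ℂ) (primeChar γ t) = primeChar (-γ) t := by
  rw [primeChar_neg, conj_eq_inv_of_norm_eq_one (norm_primeChar γ t)]

theorem primeChar_nat_mul {n : ℕ} (γ : Fin n → ℤ) (l : ℕ) (t : ℝ) :
    primeChar γ (l * t) = primeChar γ t ^ l := by
  rw [primeChar, primeChar, ← Complex.exp_nat_mul]
  push_cast
  ring_nf

theorem continuous_primeChar {n : ℕ} (γ : Fin n → ℤ) : Continuous (primeChar γ) := by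
  unfold primeChar
  fun_prop

/-- Some time step separates all characters from the trivial one. -/
theorem exists_generic_step (n : ℕ) : ∃ h : ℝ, ∀ γ : Fin n → ℤ, γ ≠ 0 → primeChar γ h ≠ 1 := by
  -- These are the solutions of primeFreq γ · h ∈ 2πℤ over all γ; they form a countable set, so some
  -- h avoids it.
  let s : Set ℝ := Set.range fun p : (Fin n → ℤ) × ℤ => -(p.2 * (2 * Real.pi)) / primeFreq p.1
  have hs : s.Countable := Set.countable_range _
  obtain ⟨h, hh⟩ := (hs.dense_compl ℝ).nonempty
  refine ⟨h, fun γ hγ h1 => hh ?_⟩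
  rw [primeChar, Complex.exp_eq_one_iff] at h1
  obtain ⟨k, hk⟩ := h1
  refine ⟨(γ, k), ?_⟩
  have h2 : (-(primeFreq γ * h) : ℂ) = k * (2 * Real.pi) := by
    apply mul_right_cancel₀ Complex.I_ne_zero
    linear_combination hk
  have h3 : -(primeFreq γ * h) = k * (2 * Real.pi) := by exact_mod_cast h2
  change -((k : ℝ) * (2 * Real.pi)) / primeFreq γ = h
  rw [← h3, neg_neg, mul_div_cancel_left₀ _ (primeFreq_ne_zero hγ)]

theorem tendsto_mean_pow {w : ℂ} (hw : ‖w‖ = 1) (h1 : w ≠ 1) :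
    Filter.Tendsto (fun L : ℕ => (L : ℂ)⁻¹ * ∑ l ∈ Finset.range L, w ^ l) Filter.atTop (nhds 0) := by
  have h2 : Filter.Tendsto (fun L : ℕ => 2 / ‖w - 1‖ * (L : ℝ)⁻¹) Filter.atTop (nhds 0) := by
    simpa using tendsto_inv_atTop_nhds_zero_nat (𝕜 := ℝ) |>.const_mul (2 / ‖w - 1‖)
  refine squeeze_zero_norm (fun L => ?_) h2
  rw [norm_mul, norm_inv, Complex.norm_natCast, mul_comm]
  gcongr
  rw [geom_sum_eq h1, norm_div]
  gcongr
  refine (norm_sub_le _ _).trans ?_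
  rw [norm_pow, hw]
  norm_num

theorem tendsto_mean_primeChar {n : ℕ} {h : ℝ}
    (hh : ∀ γ : Fin n → ℤ, γ ≠ 0 → primeChar γ h ≠ 1) (γ : Fin n → ℤ) :
    Filter.Tendsto (fun L : ℕ => (L : ℂ)⁻¹ * ∑ l ∈ Finset.range L, primeChar γ (l * h))
      Filter.atTop (nhds (if γ = 0 then 1 else 0)) := by
  split_ifs with h0
  · subst h0
    refine tendsto_const_nhds.congr' ?_
    filter_upwards [Filter.eventually_ne_atTop 0] with L hL
    simp [primeChar_zero, hL]
  · simp_rw [primeChar_nat_mul]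
    exact tendsto_mean_pow (norm_primeChar γ h) (hh γ h0)

/-! ### The Dirichlet monomials -/

section Monomials

variable {m n : ℕ}

/-- The Dirichlet monomial `s ↦ (𝔭^α) ^ (-s)`. -/
noncomputable def dirichletMonomial (α : degLE m n) : HInf logFrequency (primePowIndices m n) :=
  ⟨fun s => Complex.exp (-(logFrequency (primePow α.1) : ℂ) * s),
    Submodule.subset_span ⟨primePow α.1, ⟨α.1, mem_degLE.1 α.2, rfl⟩, rfl⟩⟩

theorem dirichletMonomial_toFun (α : degLE m n) (t : ℝ) :
    (dirichletMonomial α).toFun (t * Complex.I) = primeChar (intExp α.1) t := by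
  rw [primeChar, ← log_primePow]
  rfl

theorem span_range_dirichletMonomial :
    Submodule.span ℂ (Set.range (dirichletMonomial (m := m) (n := n))) = ⊤ := by
  rw [eq_top_iff]
  rintro ⟨D, hD⟩ -
  induction hD using Submodule.span_induction with
  | mem D hD =>
    obtain ⟨k, ⟨α, hα, rfl⟩, rfl⟩ := hD
    exact Submodule.subset_span ⟨⟨α, mem_degLE.2 hα⟩, rfl⟩
  | zero => exact Submodule.zero_mem _
  | add D E _ _ hD hE => exact Submodule.add_mem _ hD hE
  | smul a D _ hD => exact Submodule.smul_mem _ a hD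

theorem finiteDimensional_hInf :
    FiniteDimensional ℂ (HInf logFrequency (primePowIndices m n)) :=
  Module.Finite.of_fg_top (Submodule.fg_def.2 ⟨_, Set.finite_range _, span_range_dirichletMonomial⟩)

end Monomials

/-- Evaluation of a Dirichlet polynomial at the point `i t`. -/
noncomputable def HInf.evalAt {ω : ℕ → ℝ} {J : Set ℕ} (t : ℝ) : HInf ω J →ₗ[ℂ] ℂ where
  toFun D := D.toFun (t * Complex.I)
  map_add' _ _ := rfl
  map_smul' _ _ := rfl

theorem HInf.norm_evalAt_le {ω : ℕ → ℝ} {J : Set ℕ} (t : ℝ) (D : HInf ω J) :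
    ‖HInf.evalAt t D‖ ≤ ‖D‖ := le_ciSup (dirichletPolynomials_bounded D.2) t

theorem evalAt_dirichletMonomial {m n : ℕ} (α : degLE m n) (t : ℝ) :
    HInf.evalAt t (dirichletMonomial α) = primeChar (intExp α.1) t := dirichletMonomial_toFun α t

/-! ### The upper bound -/

-- Bounded scalars converge along an ultrafilter, and uniqueness of limits makes the limit linear.
open Filter in
theorem exists_linearMap_ultrafilter_limit {Y : Type*} [NormedAddCommGroup Y] [NormedSpace ℂ Y]
    {ι : Type*} (U : Ultrafilter ι) (a : ι → Y →ₗ[ℂ] ℂ) (ha : ∀ i y, ‖a i y‖ ≤ ‖y‖) :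
    ∃ c : Y →ₗ[ℂ] ℂ, ∀ y, Tendsto (fun i => a i y) U (nhds (c y)) := by
  have h (y : Y) : ∃ z, Tendsto (fun i => a i y) U (nhds z) := by
    obtain ⟨z, -, hz⟩ := (isCompact_closedBall (0 : ℂ) ‖y‖).ultrafilter_le_nhds'
      (U.map fun i => a i y) (Ultrafilter.mem_map.2 (univ_mem' fun i => by simpa using ha i y))
    exact ⟨z, hz⟩
  choose c hc using h
  refine ⟨{ toFun := c, map_add' := fun x y => ?_, map_smul' := fun r x => ?_ }, hc⟩
  · refine tendsto_nhds_unique (hc (x + y)) ?_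
    simpa using (hc x).add (hc y)
  · refine tendsto_nhds_unique (hc (r • x)) ?_
    simpa using (hc x).const_mul r

section Upper

open Filter

variable {m n : ℕ}

/-- Expanding the square, the off-diagonal terms average to zero, and each diagonal term equals one
whatever `t` is. -/
theorem tendsto_mean_norm_sq_kernel {h : ℝ}
    (hh : ∀ γ : Fin n → ℤ, γ ≠ 0 → primeChar γ h ≠ 1) (t : ℝ) :
    Tendsto (fun L : ℕ => (L : ℝ)⁻¹ * ∑ l ∈ Finset.range L,
      ‖∑ α : degLE m n, primeChar (-intExp α.1) (l * h) * primeChar (intExp α.1) t‖ ^ 2)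
      atTop (nhds (degLE m n).card) := by
  have h1 : Tendsto (fun L : ℕ => ∑ α : degLE m n, ∑ β : degLE m n,
      primeChar (intExp α.1 - intExp β.1) t * ((L : ℂ)⁻¹ * ∑ l ∈ Finset.range L,
        primeChar (intExp β.1 - intExp α.1) (l * h))) atTop
      (nhds (∑ α : degLE m n, ∑ β : degLE m n, primeChar (intExp α.1 - intExp β.1) t *
        if intExp β.1 - intExp α.1 = 0 then 1 else 0)) :=
    tendsto_finsetSum _ fun α _ => tendsto_finsetSum _ fun β _ =>
      (tendsto_mean_primeChar hh _).const_mul _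
  have h2 (α β : degLE m n) : intExp β.1 - intExp α.1 = 0 ↔ α = β := by
    rw [sub_eq_zero, intExp_injective.eq_iff, Subtype.ext_iff, eq_comm]
  have h3 : (∑ α : degLE m n, ∑ β : degLE m n, primeChar (intExp α.1 - intExp β.1) t *
        if intExp β.1 - intExp α.1 = 0 then (1 : ℂ) else 0) = (degLE m n).card := by
    simp [h2, primeChar_zero]
  rw [h3] at h1
  have h4 := (Complex.continuous_re.tendsto _).comp h1
  rw [Complex.natCast_re] at h4
  refine h4.congr fun L => ?_
  have h5 : ((((L : ℝ)⁻¹ * ∑ l ∈ Finset.range L,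
      ‖∑ α : degLE m n, primeChar (-intExp α.1) (l * h) * primeChar (intExp α.1) t‖ ^ 2 : ℝ)) : ℂ) =
      ∑ α : degLE m n, ∑ β : degLE m n,
      primeChar (intExp α.1 - intExp β.1) t * ((L : ℂ)⁻¹ * ∑ l ∈ Finset.range L,
        primeChar (intExp β.1 - intExp α.1) (l * h)) := by
    have h6 (l : ℕ) : ((‖∑ α : degLE m n, primeChar (-intExp α.1) (l * h) *
        primeChar (intExp α.1) t‖ ^ 2 : ℝ) : ℂ) = ∑ α : degLE m n, ∑ β : degLE m n,
        primeChar (intExp α.1 - intExp β.1) t * primeChar (intExp β.1 - intExp α.1) (l * h) := by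
      rw [← Complex.normSq_eq_norm_sq, ← Complex.mul_conj, map_sum, Finset.sum_mul_sum]
      refine Finset.sum_congr rfl fun α _ => Finset.sum_congr rfl fun β _ => ?_
      rw [map_mul, conj_primeChar, conj_primeChar, neg_neg, sub_eq_add_neg, sub_eq_add_neg,
        primeChar_add, primeChar_add]
      ring
    push_cast at h6 ⊢
    simp_rw [h6]
    rw [Finset.sum_comm, Finset.mul_sum]
    refine Finset.sum_congr rfl fun α _ => ?_
    rw [Finset.sum_comm, Finset.mul_sum]
    refine Finset.sum_congr rfl fun β _ => ?_
    rw [← Finset.mul_sum]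
    ring
  rw [Function.comp_apply, ← h5, Complex.ofReal_re]

theorem exists_extension_evalAt {Y : Type v} [NormedAddCommGroup Y] [NormedSpace ℂ Y]
    (I : HInf logFrequency (primePowIndices m n) →ₗᵢ[ℂ] Y) (t : ℝ) :
    ∃ φ : Y →L[ℂ] ℂ, (∀ D, φ (I D) = HInf.evalAt t D) ∧ ∀ y, ‖φ y‖ ≤ ‖y‖ := by
  let f : LinearMap.range I.toLinearMap →L[ℂ] ℂ :=
    ((HInf.evalAt t).mkContinuous 1 fun D => by simpa using HInf.norm_evalAt_le t D).comp
      (I.equivRange.symm.toContinuousLinearEquiv : LinearMap.range I.toLinearMap →L[ℂ]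
        HInf logFrequency (primePowIndices m n))
  obtain ⟨φ, hφ, hφf⟩ := exists_extension_norm_eq _ f
  have hf : ‖f‖ ≤ 1 := by
    refine f.opNorm_le_bound zero_le_one fun x => ?_
    rw [one_mul]
    refine (HInf.norm_evalAt_le t _).trans (le_of_eq ?_)
    exact I.equivRange.symm.norm_map x
  refine ⟨φ, fun D => ?_, fun y => ?_⟩
  · have h1 := hφ (I.equivRange D)
    have h2 : f (I.equivRange D) = HInf.evalAt t D := by
      change HInf.evalAt t (I.equivRange.symm (I.equivRange D)) = _
      rw [LinearIsometryEquiv.symm_apply_apply]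
    rw [← h2, ← h1]
    rfl
  · refine (φ.le_opNorm y).trans ?_
    rw [hφf]
    exact mul_le_of_le_one_left (norm_nonneg y) hf

theorem exists_projection {Y : Type v} [NormedAddCommGroup Y] [NormedSpace ℂ Y]
    (I : HInf logFrequency (primePowIndices m n) →ₗᵢ[ℂ] Y) :
    ∃ P : Y →ₗ[ℂ] HInf logFrequency (primePowIndices m n),
      (∀ D, P (I D) = D) ∧ ∀ y, ‖P y‖ ≤ Real.sqrt (degLE m n).card * ‖y‖ := by
  obtain ⟨h, hh⟩ := exists_generic_step n
  choose φ hφ hφn using exists_extension_evalAt I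
  let a (γ : Fin n → ℤ) (L : ℕ) : Y →ₗ[ℂ] ℂ :=
    (L : ℂ)⁻¹ • ∑ l ∈ Finset.range L, primeChar (-γ) (l * h) • (φ (l * h)).toLinearMap
  have ha (γ : Fin n → ℤ) (L : ℕ) (y : Y) : a γ L y =
      (L : ℂ)⁻¹ * ∑ l ∈ Finset.range L, primeChar (-γ) (l * h) * φ (l * h) y := by
    simp [a, LinearMap.sum_apply]
  have hmean (L : ℕ) (x : ℕ → ℝ) : (L : ℝ)⁻¹ * ∑ l ∈ Finset.range L, x l ≤
      -- Cauchy–Schwarz for means; it is where the L¹ norm of the kernel is traded for its L² norm,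
      -- which produces the square root in the upper bound.
      Real.sqrt ((L : ℝ)⁻¹ * ∑ l ∈ Finset.range L, x l ^ 2) := by
    refine Real.le_sqrt_of_sq_le ?_
    have h1 := sq_sum_le_card_mul_sum_sq (s := Finset.range L) (f := x)
    rw [Finset.card_range] at h1
    rcases Nat.eq_zero_or_pos L with rfl | hL
    · simp
    · have hL' : (0 : ℝ) < L := by exact_mod_cast hL
      calc _ = (L : ℝ)⁻¹ ^ 2 * (∑ l ∈ Finset.range L, x l) ^ 2 := by ring
        _ ≤ (L : ℝ)⁻¹ ^ 2 * (L * ∑ l ∈ Finset.range L, x l ^ 2) := by gcongr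
        _ = _ := by field_simp
  have han (γ : Fin n → ℤ) (L : ℕ) (y : Y) : ‖a γ L y‖ ≤ ‖y‖ := by
    rw [ha, norm_mul, norm_inv, Complex.norm_natCast]
    rcases Nat.eq_zero_or_pos L with rfl | hL
    · simp
    · have hL' : (0 : ℝ) < L := by exact_mod_cast hL
      rw [inv_mul_le_iff₀ hL']
      refine (norm_sum_le_of_le _ (n := fun _ => ‖y‖) fun l _ => ?_).trans (by simp)
      rw [norm_mul, norm_primeChar, one_mul]
      exact hφn _ y
  have hU : (hyperfilter ℕ : Filter ℕ) ≤ atTop := Nat.hyperfilter_le_atTop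
  choose c hc using fun γ : Fin n → ℤ =>
    exists_linearMap_ultrafilter_limit (hyperfilter ℕ) (a γ) (han γ)
  let P : Y →ₗ[ℂ] HInf logFrequency (primePowIndices m n) :=
    ∑ α : degLE m n, (c (intExp α.1)).smulRight (dirichletMonomial α)
  have hP (y : Y) : P y = ∑ α : degLE m n, c (intExp α.1) y • dirichletMonomial α := by
    simp [P, LinearMap.sum_apply]
  refine ⟨P, ?_, fun y => ?_⟩
  · have hid : P ∘ₗ I.toLinearMap = LinearMap.id := by
      refine LinearMap.ext_on_range span_range_dirichletMonomial fun β => ?_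
      have hcβ (α : degLE m n) : c (intExp α.1) (I (dirichletMonomial β)) =
          if α = β then 1 else 0 := by
        refine tendsto_nhds_unique (hc _ _) ?_
        have h1 := (tendsto_mean_primeChar hh (-intExp α.1 + intExp β.1)).mono_left hU
        have h2 : (-intExp α.1 + intExp β.1 = 0) ↔ α = β := by
          rw [neg_add_eq_zero, intExp_injective.eq_iff, Subtype.ext_iff]
        simp_rw [h2, primeChar_add] at h1
        simpa only [ha, hφ, evalAt_dirichletMonomial] using h1
      simp [hP, hcβ]
    exact fun D => LinearMap.congr_fun hid D
  · refine ciSup_le fun t => ?_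
    change ‖HInf.evalAt t (P y)‖ ≤ _
    let K (l : ℕ) : ℂ := ∑ α : degLE m n, primeChar (-intExp α.1) (l * h) * primeChar (intExp α.1) t
    have h1 : Tendsto (fun L => ‖∑ α : degLE m n, a (intExp α.1) L y * primeChar (intExp α.1) t‖)
        (hyperfilter ℕ) (nhds ‖HInf.evalAt t (P y)‖) := by
      have : HInf.evalAt t (P y) =
          ∑ α : degLE m n, c (intExp α.1) y * primeChar (intExp α.1) t := by
        simp [hP, map_sum, evalAt_dirichletMonomial]
      rw [this]
      exact (tendsto_finsetSum _ fun α _ => (hc _ y).mul_const _).norm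
    have h2 : Tendsto (fun L : ℕ => Real.sqrt ((L : ℝ)⁻¹ * ∑ l ∈ Finset.range L, ‖K l‖ ^ 2) * ‖y‖)
        (hyperfilter ℕ) (nhds (Real.sqrt (degLE m n).card * ‖y‖)) :=
      (((tendsto_mean_norm_sq_kernel hh t).mono_left hU).sqrt).mul_const _
    refine le_of_tendsto_of_tendsto' h1 h2 fun L => ?_
    have h3 : ∑ α : degLE m n, a (intExp α.1) L y * primeChar (intExp α.1) t =
        (L : ℂ)⁻¹ * ∑ l ∈ Finset.range L, φ (l * h) y * K l := by
      simp_rw [ha, K, Finset.mul_sum, Finset.sum_mul]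
      rw [Finset.sum_comm]
      refine Finset.sum_congr rfl fun l _ => Finset.sum_congr rfl fun α _ => ?_
      ring
    rw [h3, norm_mul, norm_inv, Complex.norm_natCast]
    calc (L : ℝ)⁻¹ * ‖∑ l ∈ Finset.range L, φ (l * h) y * K l‖
        ≤ (L : ℝ)⁻¹ * ∑ l ∈ Finset.range L, ‖K l‖ * ‖y‖ := by
          gcongr
          refine norm_sum_le_of_le _ fun l _ => ?_
          rw [norm_mul, mul_comm]
          gcongr
          exact hφn _ y
      _ = ((L : ℝ)⁻¹ * ∑ l ∈ Finset.range L, ‖K l‖) * ‖y‖ := by rw [← Finset.sum_mul, mul_assoc]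
      _ ≤ _ := by
          gcongr
          exact hmean L _

theorem relProjConst_range_le {Y : Type v} [NormedAddCommGroup Y] [NormedSpace ℂ Y]
    (I : HInf logFrequency (primePowIndices m n) →ₗᵢ[ℂ] Y) :
    relProjConst (LinearMap.range I.toLinearMap) ≤
      ENNReal.ofReal (Real.sqrt (degLE m n).card) := by
  obtain ⟨P, hPI, hPn⟩ := exists_projection I
  let Q : Y →L[ℂ] LinearMap.range I.toLinearMap :=
    (I.equivRange.toContinuousLinearEquiv : _ →L[ℂ] LinearMap.range I.toLinearMap).comp
      (P.mkContinuous _ hPn)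
  have hQ (y : Y) : Q y = I.equivRange (P y) := rfl
  refine (iInf₂_le Q ?_).trans ?_
  · rintro ⟨_, D, rfl⟩
    rw [hQ]
    apply Subtype.ext
    change I (P (I D)) = I D
    rw [hPI]
  · rw [← ofReal_norm]
    refine ENNReal.ofReal_le_ofReal (Q.opNorm_le_bound (Real.sqrt_nonneg _) fun y => ?_)
    rw [hQ, LinearIsometryEquiv.norm_map]
    exact hPn y

theorem projConst_le :
    projConst.{0, v} (HInf logFrequency (primePowIndices m n)) ≤
      ENNReal.ofReal (Real.sqrt (degLE m n).card) :=
  iSup_le fun _ => iSup_le fun _ => iSup_le fun _ => iSup_le fun _ => iSup_le fun I =>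
    iSup_le fun _ => relProjConst_range_le I

end Upper

/-! ### Trigonometric polynomials -/

section Trigonometric

open AddMonoidAlgebra Filter

variable {m n : ℕ}

/-- The character of `ℤⁿ` given by a time. -/
noncomputable def timeHom (n : ℕ) (t : ℝ) : Multiplicative (Fin n → ℤ) →* ℂ where
  toFun γ := primeChar γ.toAdd t
  map_one' := primeChar_zero t
  map_mul' γ δ := primeChar_add γ.toAdd δ.toAdd t

/-- The character of `ℤⁿ` given by a point of a grid on the torus. -/
noncomputable def gridHom {M : ℕ} (j : Fin n → Fin M) : Multiplicative (Fin n → ℤ) →* ℂ where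
  toFun γ := ∏ i, unitRoot M (j i) ^ γ.toAdd i
  map_one' := by simp
  map_mul' γ δ := by
    rw [← Finset.prod_mul_distrib]
    exact Finset.prod_congr rfl fun i _ => zpow_add₀ (unitRoot_ne_zero M (j i)) _ _

theorem norm_gridHom {M : ℕ} (j : Fin n → Fin M) (γ : Multiplicative (Fin n → ℤ)) :
    ‖gridHom j γ‖ = 1 := by
  simp [gridHom, norm_unitRoot]

theorem sum_gridHom {M : ℕ} (γ : Fin n → ℤ) (hγ : ∀ i, (γ i).natAbs < M) :
    (M : ℂ)⁻¹ ^ n * ∑ j : Fin n → Fin M, gridHom j (Multiplicative.ofAdd γ) =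
      if γ = 0 then 1 else 0 := by
  have h1 : ∑ j : Fin n → Fin M, gridHom j (Multiplicative.ofAdd γ) =
      ∏ i, ∑ l : Fin M, unitRoot M l ^ γ i := by
    rw [Finset.prod_univ_sum, Fintype.piFinset_univ]
    rfl
  rw [h1]
  split_ifs with h
  · rcases Nat.eq_zero_or_pos n with rfl | hn
    · simp
    · have hM : (M : ℂ) ≠ 0 := by
        have := hγ ⟨0, hn⟩
        exact_mod_cast (by omega : M ≠ 0)
      simp [h, hM]
  · obtain ⟨i, hi⟩ := Function.ne_iff.1 h
    have hM : M ≠ 0 := by have := hγ i; omega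
    rw [Finset.prod_eq_zero (Finset.mem_univ i), mul_zero]
    rw [sum_unitRoot_zpow hM, if_neg]
    intro hd
    have h2 := hγ i
    exact hi (Int.eq_zero_of_abs_lt_dvd hd (by rw [Int.abs_eq_natAbs]; exact_mod_cast h2))

/-- Grid means are exact, not merely convergent, once `M` exceeds every exponent that occurs. -/
theorem eventually_mean_gridHom (G : AddMonoidAlgebra ℂ (Fin n → ℤ)) :
    ∀ᶠ M : ℕ in atTop, (M : ℂ)⁻¹ ^ n * ∑ j : Fin n → Fin M, lift ℂ ℂ _ (gridHom j) G =
      G.coeff 0 := by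
  induction G using AddMonoidAlgebra.induction_linear with
  | zero => simp
  | add F G hF hG =>
    filter_upwards [hF, hG] with M hF hG
    simp only [map_add, Finset.sum_add_distrib, mul_add, hF, hG, coeff_add, Finsupp.add_apply]
  | single γ r =>
    filter_upwards [eventually_gt_atTop (∑ i, (γ i).natAbs)] with M hM
    have hγ (i : Fin n) : (γ i).natAbs < M :=
      (Finset.single_le_sum (f := fun i => (γ i).natAbs) (fun _ _ => Nat.zero_le _)
        (Finset.mem_univ i)).trans_lt hM
    simp only [lift_single, smul_eq_mul, ← Finset.mul_sum]
    rw [mul_left_comm, sum_gridHom γ hγ, coeff_single, Finsupp.single_apply]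
    simp

/-! ### The Dirichlet kernel and its approximate phase -/

/-- The Dirichlet kernel `∑ z ^ α` over the multi-indices of order at most `m`. -/
noncomputable def dirichletKernel (m n : ℕ) : AddMonoidAlgebra ℂ (Fin n → ℤ) :=
  ∑ α ∈ degLE m n, single (intExp α) 1

/-- The conjugate of the Dirichlet kernel on the torus. -/
noncomputable def conjDirichletKernel (m n : ℕ) : AddMonoidAlgebra ℂ (Fin n → ℤ) :=
  ∑ α ∈ degLE m n, single (-intExp α) 1

theorem coeff_mul_conjDirichletKernel (F : AddMonoidAlgebra ℂ (Fin n → ℤ)) :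
    (F * conjDirichletKernel m n).coeff 0 = ∑ α ∈ degLE m n, F.coeff (intExp α) := by
  rw [conjDirichletKernel, Finset.mul_sum, coeff_sum, Finsupp.finsetSum_apply]
  refine Finset.sum_congr rfl fun α _ => ?_
  rw [coeff_mul_single_eq_coeff_mul (intExp α), mul_one]
  intro γ _
  rw [add_neg_eq_zero]

variable {χ : Multiplicative (Fin n → ℤ) →* ℂ}

theorem lift_dirichletKernel (χ : Multiplicative (Fin n → ℤ) →* ℂ) :
    lift ℂ ℂ _ χ (dirichletKernel m n) = ∑ α ∈ degLE m n, χ (Multiplicative.ofAdd (intExp α)) := by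
  simp [dirichletKernel]

theorem norm_lift_dirichletKernel_le (hχ : ∀ γ, ‖χ γ‖ = 1) :
    ‖lift ℂ ℂ _ χ (dirichletKernel m n)‖ ≤ (degLE m n).card := by
  rw [lift_dirichletKernel]
  exact (norm_sum_le_of_le _ fun α _ => (hχ _).le).trans (by simp)

theorem lift_conjDirichletKernel (hχ : ∀ γ, ‖χ γ‖ = 1) :
    lift ℂ ℂ _ χ (conjDirichletKernel m n) =
      (starRingEnd ℂ) (lift ℂ ℂ _ χ (dirichletKernel m n)) := by
  rw [lift_dirichletKernel, map_sum, conjDirichletKernel, map_sum]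
  refine Finset.sum_congr rfl fun α _ => ?_
  rw [lift_single, one_smul, conj_eq_inv_of_norm_eq_one (hχ _), ofAdd_neg]
  refine eq_inv_of_mul_eq_one_left ?_
  rw [← map_mul, inv_mul_cancel, map_one]

/-- The trigonometric polynomial `K q(|K|²)`, where `K` is the Dirichlet kernel. -/
noncomputable def kernelTransform (m n : ℕ) (q : Polynomial ℝ) : AddMonoidAlgebra ℂ (Fin n → ℤ) :=
  dirichletKernel m n *
    Polynomial.aeval (dirichletKernel m n * conjDirichletKernel m n) (q.map (algebraMap ℝ ℂ))

theorem lift_kernelTransform (hχ : ∀ γ, ‖χ γ‖ = 1) (q : Polynomial ℝ) :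
    lift ℂ ℂ _ χ (kernelTransform m n q) = lift ℂ ℂ _ χ (dirichletKernel m n) *
      (q.eval (‖lift ℂ ℂ _ χ (dirichletKernel m n)‖ ^ 2) : ℝ) := by
  rw [kernelTransform, map_mul, ← Polynomial.aeval_algHom_apply, map_mul,
    lift_conjDirichletKernel hχ, Complex.mul_conj, Complex.normSq_eq_norm_sq]
  congr 1
  rw [Polynomial.aeval_def, Polynomial.eval₂_map]
  exact (Polynomial.eval₂_at_apply (algebraMap ℝ ℂ) _)

/-- By Weierstrass, q(y) approximates 1 / √(y + δ), so K q(|K|²) is nearly bounded by one while its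
product with the conjugate of K is nearly at least |K|. The estimates hold for all x in [0, N],
hence for time and grid characters alike, and no density of the time orbit in the torus is needed.
-/
theorem exists_polynomial_approx_sign (N : ℝ) (hN : 0 ≤ N) {ε : ℝ} (hε : 0 < ε) :
    ∃ q : Polynomial ℝ, ∀ x ∈ Set.Icc 0 N,
      |x * q.eval (x ^ 2)| ≤ 1 + ε ∧ x - ε ≤ x ^ 2 * q.eval (x ^ 2) := by
  -- Half of ε pays for the regularization, as √(x² + δ) ≤ x + ε / 2. The other half pays for the
  -- approximation: η is chosen so that both x η and x² η are at most ε / 2.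
  set δ : ℝ := (ε / 2) ^ 2 with hδ
  have hδ0 : 0 < δ := by positivity
  set η : ℝ := ε / (2 * (1 + N) ^ 2) with hη
  have hη0 : 0 < η := by positivity
  have hcont : ContinuousOn (fun y : ℝ => (Real.sqrt (y + δ))⁻¹) (Set.Icc 0 (N ^ 2)) := by
    refine ContinuousOn.inv₀ (by fun_prop) fun y hy => ?_
    have := hy.1
    exact (Real.sqrt_pos.2 (by linarith)).ne'
  obtain ⟨q, hq⟩ := exists_polynomial_near_of_continuousOn 0 (N ^ 2) _ hcont η hη0
  refine ⟨q, fun x hx => ?_⟩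
  obtain ⟨hx0, hxN⟩ := hx
  have h1 := (abs_lt.1 (hq (x ^ 2) ⟨sq_nonneg x, pow_le_pow_left₀ hx0 hxN 2⟩))
  set s := Real.sqrt (x ^ 2 + δ) with hs
  have hs0 : 0 < s := Real.sqrt_pos.2 (by positivity)
  have hss : s ^ 2 = x ^ 2 + δ := Real.sq_sqrt (by positivity)
  have hxs : x ≤ s := Real.le_sqrt_of_sq_le (by linarith)
  have hsx : s ≤ x + ε / 2 := by
    refine Real.sqrt_le_iff.2 ⟨by positivity, ?_⟩
    nlinarith [mul_nonneg hx0 hε.le]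
  have hx1 : x * s⁻¹ ≤ 1 := by
    rw [← div_eq_mul_inv, div_le_one hs0]
    exact hxs
  have hx2 : 0 ≤ x * s⁻¹ := by positivity
  have hεs : ε / 2 ≤ s := Real.le_sqrt_of_sq_le (by rw [← hδ]; nlinarith)
  have hx3 : x - ε / 2 ≤ x ^ 2 * s⁻¹ := by
    rw [← div_eq_mul_inv, le_div_iff₀ hs0]
    nlinarith
  have hηN : η * (1 + N) ^ 2 = ε / 2 := by
    rw [hη]
    field_simp
  have hxη : x * η ≤ ε / 2 := by
    rw [← hηN, mul_comm]
    gcongr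
    nlinarith
  have hxη2 : x ^ 2 * η ≤ ε / 2 := by
    rw [← hηN, mul_comm]
    gcongr
    linarith
  refine ⟨abs_le.2 ⟨?_, ?_⟩, ?_⟩
  · nlinarith [mul_nonneg hx0 (sub_nonneg.2 h1.1.le)]
  · nlinarith [mul_nonneg hx0 (sub_nonneg.2 h1.2.le)]
  · nlinarith [mul_nonneg (sq_nonneg x) (sub_nonneg.2 h1.1.le)]

theorem sum_degLE {β : Type*} [AddCommMonoid β] (g : (Fin n → ℕ) → β) :
    ∑ α ∈ degLE m n, g α = ∑ α : Fin n → Fin (m + 1),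
      if ∑ i, (α i : ℕ) ≤ m then g (fun i => α i) else 0 := by
  rw [degLE, Finset.sum_filter]
  symm
  refine Finset.sum_nbij (fun α i => (α i : ℕ)) (fun α _ => ?_) (fun α _ β _ h => ?_)
    (fun α hα => ?_) fun α _ => rfl
  · simpa using fun i => (α i).2
  · exact funext fun i => Fin.ext (congrFun h i)
  · have h : ∀ i, α i < m + 1 := by simpa using hα
    exact ⟨fun i => ⟨α i, h i⟩, by simp, rfl⟩

/-- A lower bound for the mean of the modulus of the Dirichlet kernel over a grid on the torus. -/
theorem card_div_two_pow_le {M : ℕ} (hM : m < M) :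
    ((degLE m n).card : ℝ) / 2 ^ m ≤ ((1 + 2 * Real.pi * (m + 1) * m / M) ^ n *
        ((M : ℝ)⁻¹ ^ n * ∑ j : Fin n → Fin M,
          ‖lift ℂ ℂ _ (gridHom j) (dirichletKernel m n)‖)) ^ 2 := by
  have h := sum_norm_sq_div_two_pow_sum_le hM n
    fun α => if ∑ i, (α i : ℕ) ≤ m then (1 : ℂ) else 0
  have h1 (j : Fin n → Fin M) : ∑ α : Fin n → Fin (m + 1),
      (if ∑ i, (α i : ℕ) ≤ m then (1 : ℂ) else 0) * ∏ i, unitRoot M (j i) ^ (α i : ℕ) =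
        lift ℂ ℂ _ (gridHom j) (dirichletKernel m n) := by
    rw [lift_dirichletKernel, sum_degLE]
    refine Finset.sum_congr rfl fun α _ => ?_
    rw [ite_mul, one_mul, zero_mul]
    simp [gridHom, intExp]
  simp_rw [h1] at h
  refine le_trans ?_ h
  rw [Finset.card_eq_sum_ones, Nat.cast_sum, sum_degLE, Finset.sum_div]
  -- Every multi-index in the kernel has order at most `m`, so its weight is at least 1 / 2 ^ m.
  refine Finset.sum_le_sum fun α _ => ?_
  split_ifs with h2
  · simp only [Nat.cast_one, norm_one, one_pow]
    gcongr
    norm_num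
  · simp

end Trigonometric

/-! ### The lower bound -/

section Lower

open AddMonoidAlgebra Filter
open scoped BoundedContinuousFunction

variable {m n : ℕ}

/-- The restriction of a Dirichlet polynomial to the imaginary axis. -/
noncomputable def restrictAxis {ω : ℕ → ℝ} {J : Set ℕ} : HInf ω J →ₗ[ℂ] (ℝ →ᵇ ℂ) where
  toFun D := BoundedContinuousFunction.ofNormedAddCommGroup (fun t : ℝ => D.toFun (t * Complex.I))
    ((dirichletPolynomials_differentiable D.2).continuous.comp (by fun_prop)) ‖D‖
    fun t => HInf.norm_evalAt_le t D
  map_add' _ _ := rfl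
  map_smul' _ _ := rfl

/-- The isometric embedding of the Dirichlet polynomials into the bounded continuous functions. -/
noncomputable def axisEmbedding (ω : ℕ → ℝ) (J : Set ℕ) :
    HInf ω J →ₗᵢ[ℂ] ULift.{v} (ℝ →ᵇ ℂ) where
  toLinearMap := (LinearIsometryEquiv.ulift ℂ (ℝ →ᵇ ℂ)).symm.toLinearEquiv.toLinearMap ∘ₗ
    restrictAxis
  norm_map' D := by
    change ‖restrictAxis D‖ = ‖D‖
    rw [BoundedContinuousFunction.norm_eq_iSup_norm]
    rfl

theorem axisEmbedding_apply {ω : ℕ → ℝ} {J : Set ℕ} (D : HInf ω J) :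
    axisEmbedding.{v} ω J D = ULift.up (restrictAxis D) := rfl

/-- A character of the real line as a bounded continuous function. -/
noncomputable def charBCF (γ : Fin n → ℤ) : ℝ →ᵇ ℂ :=
  BoundedContinuousFunction.ofNormedAddCommGroup (primeChar γ) (continuous_primeChar γ) 1
    fun t => (norm_primeChar γ t).le

theorem restrictAxis_dirichletMonomial (α : degLE m n) :
    restrictAxis (dirichletMonomial α) = charBCF (intExp α.1) :=
  BoundedContinuousFunction.ext fun t => dirichletMonomial_toFun α t

theorem tendsto_mean_evalAt_neg {h : ℝ}
    (hh : ∀ γ : Fin n → ℤ, γ ≠ 0 → primeChar γ h ≠ 1) {γ : Fin n → ℤ}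
    (hγ : γ ∉ (degLE m n).image intExp) (D : HInf logFrequency (primePowIndices m n)) :
    Tendsto (fun L : ℕ => (L : ℂ)⁻¹ * ∑ l ∈ Finset.range L,
      primeChar γ (l * h) * HInf.evalAt (-(l * h)) D) atTop (nhds 0) := by
  have hD : D ∈ Submodule.span ℂ (Set.range (dirichletMonomial (m := m) (n := n))) := by
    rw [span_range_dirichletMonomial]
    trivial
  induction hD using Submodule.span_induction with
  | mem D hD =>
    obtain ⟨α, rfl⟩ := hD
    have h1 := tendsto_mean_primeChar hh (γ + -intExp α.1)
    rw [if_neg] at h1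
    · simpa only [evalAt_dirichletMonomial, primeChar_neg_time, primeChar_add] using h1
    · rw [add_neg_eq_zero]
      rintro rfl
      exact hγ (Finset.mem_image_of_mem _ α.2)
  | zero => simp
  | add D E _ _ hD hE => simpa [mul_add, Finset.sum_add_distrib] using hD.add hE
  | smul a D _ hD =>
    refine (by simpa using hD.const_mul a : Tendsto _ _ (nhds (0 : ℂ))).congr fun L => ?_
    simp only [map_smul, smul_eq_mul, Finset.mul_sum]
    exact Finset.sum_congr rfl fun _ _ => by ring

/-- Translate F by τ, apply `Q`, evaluate at -τ, and average over τ. A character in Λ is fixed by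
`Q` and contributes its coefficient. Any other character is sent into the span of Λ, where
orthogonality kills the average, so nothing about its image need be known. Each averaged value is at
most C B. -/
theorem norm_sum_coeff_le {Q : ULift.{v} (ℝ →ᵇ ℂ) →ₗ[ℂ] HInf logFrequency (primePowIndices m n)}
    (hQ : ∀ D, Q (axisEmbedding.{v} _ _ D) = D) {C : ℝ} (hC0 : 0 ≤ C) (hC : ∀ y, ‖Q y‖ ≤ C * ‖y‖)
    (F : AddMonoidAlgebra ℂ (Fin n → ℤ)) {B : ℝ} (hB0 : 0 ≤ B)
    (hB : ∀ t, ‖lift ℂ ℂ _ (timeHom n t) F‖ ≤ B) :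
    ‖∑ α ∈ degLE m n, F.coeff (intExp α)‖ ≤ C * B := by
  obtain ⟨h, hh⟩ := exists_generic_step n
  let shift (τ : ℝ) : ℝ →ᵇ ℂ :=
    ∑ γ ∈ F.coeff.support, (F.coeff γ * primeChar γ τ) • charBCF γ
  have hshift (τ : ℝ) : ‖shift τ‖ ≤ B := by
    rw [BoundedContinuousFunction.norm_le hB0]
    intro t
    have h1 : shift τ t = lift ℂ ℂ _ (timeHom n (τ + t)) F := by
      rw [lift_apply, Finsupp.sum]
      simp only [shift, BoundedContinuousFunction.coe_sum, Finset.sum_apply]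
      refine Finset.sum_congr rfl fun γ _ => ?_
      change F.coeff γ * primeChar γ τ * primeChar γ t = F.coeff γ * primeChar γ (τ + t)
      rw [primeChar_add_time, mul_assoc]
    rw [h1]
    exact hB _
  let q (γ : Fin n → ℤ) : HInf logFrequency (primePowIndices m n) := Q (ULift.up (charBCF γ))
  have hQshift (τ : ℝ) : Q (ULift.up (shift τ)) =
      ∑ γ ∈ F.coeff.support, (F.coeff γ * primeChar γ τ) • q γ := by
    have h1 : (ULift.up (shift τ) : ULift.{v} (ℝ →ᵇ ℂ)) =
        ∑ γ ∈ F.coeff.support, (F.coeff γ * primeChar γ τ) • ULift.up (charBCF γ) := by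
      have := map_sum (LinearIsometryEquiv.ulift ℂ (ℝ →ᵇ ℂ)).symm
        (fun γ => (F.coeff γ * primeChar γ τ) • charBCF γ) F.coeff.support
      exact this
    rw [h1, map_sum]
    exact Finset.sum_congr rfl fun γ _ => map_smul _ _ _
  have hmean (γ : Fin n → ℤ) : Tendsto (fun L : ℕ => (L : ℂ)⁻¹ * ∑ l ∈ Finset.range L,
      primeChar γ (l * h) * HInf.evalAt (-(l * h)) (q γ)) atTop
      (nhds (if γ ∈ (degLE m n).image intExp then 1 else 0)) := by
    split_ifs with hγ
    · obtain ⟨α, hα, rfl⟩ := Finset.mem_image.1 hγ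
      have h1 : q (intExp α) = dirichletMonomial ⟨α, hα⟩ := by
        rw [← hQ (dirichletMonomial ⟨α, hα⟩), axisEmbedding_apply, restrictAxis_dirichletMonomial]
      have h2 := tendsto_mean_primeChar hh (intExp α + -intExp α)
      rw [if_pos (add_neg_cancel _)] at h2
      simpa only [h1, evalAt_dirichletMonomial, primeChar_neg_time, primeChar_add] using h2
    · exact tendsto_mean_evalAt_neg hh hγ (q γ)
  have hlim : Tendsto (fun L : ℕ => (L : ℂ)⁻¹ * ∑ l ∈ Finset.range L,
      HInf.evalAt (-(l * h)) (Q (ULift.up (shift (l * h))))) atTop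
      (nhds (∑ α ∈ degLE m n, F.coeff (intExp α))) := by
    have h1 : ∑ α ∈ degLE m n, F.coeff (intExp α) = ∑ γ ∈ F.coeff.support,
        F.coeff γ * if γ ∈ (degLE m n).image intExp then 1 else 0 := by
      rw [← Finset.sum_image (g := intExp) (f := fun γ => F.coeff γ) intExp_injective.injOn]
      simp only [mul_ite, mul_one, mul_zero]
      rw [← Finset.sum_filter, Finset.filter_mem_eq_inter]
      refine (Finset.sum_subset Finset.inter_subset_right fun γ hγ hγ' => ?_).symm
      by_contra h0
      exact hγ' (Finset.mem_inter.2 ⟨Finsupp.mem_support_iff.2 h0, hγ⟩)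
    rw [h1]
    refine (tendsto_finsetSum _ fun γ _ => (hmean γ).const_mul (F.coeff γ)).congr fun L => ?_
    simp_rw [hQshift, map_sum, map_smul, smul_eq_mul, Finset.mul_sum]
    rw [Finset.sum_comm]
    exact Finset.sum_congr rfl fun l _ => Finset.sum_congr rfl fun γ _ => by ring
  refine le_of_tendsto hlim.norm ?_
  filter_upwards [eventually_gt_atTop 0] with L hL
  have hL' : (0 : ℝ) < L := by exact_mod_cast hL
  rw [norm_mul, norm_inv, Complex.norm_natCast, inv_mul_le_iff₀ hL']
  refine (norm_sum_le_of_le _ (n := fun _ => C * B) fun l _ => ?_).trans (by simp)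
  refine (HInf.norm_evalAt_le _ _).trans ((hC _).trans ?_)
  rw [ULift.norm_up]
  gcongr
  exact hshift _

theorem sqrt_card_div_two_pow_le
    {Q : ULift.{v} (ℝ →ᵇ ℂ) →ₗ[ℂ] HInf logFrequency (primePowIndices m n)}
    (hQ : ∀ D, Q (axisEmbedding.{v} _ _ D) = D) {C : ℝ} (hC0 : 0 ≤ C)
    (hC : ∀ y, ‖Q y‖ ≤ C * ‖y‖) : Real.sqrt ((degLE m n).card / 2 ^ m) ≤ C := by
  set N : ℝ := ((degLE m n).card : ℝ) with hN
  have key (ε : ℝ) (hε : 0 < ε) : Real.sqrt (N / 2 ^ m) ≤ C * (1 + ε) + ε := by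
    obtain ⟨q, hq⟩ := exists_polynomial_approx_sign N (Nat.cast_nonneg _) hε
    -- By `coeff_mul_conjDirichletKernel` this sum is the constant coefficient of F times the
    -- conjugate kernel, hence the mean of |K|² q(|K|²) over fine grids, which is at least the mean
    -- of |K| minus ε.
    have h1 : ‖∑ α ∈ degLE m n, (kernelTransform m n q).coeff (intExp α)‖ ≤ C * (1 + ε) := by
      refine norm_sum_coeff_le hQ hC0 hC _ (by positivity) fun t => ?_
      have hχ (γ : Multiplicative (Fin n → ℤ)) : ‖timeHom n t γ‖ = 1 := norm_primeChar _ t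
      rw [lift_kernelTransform hχ, norm_mul, Complex.norm_real, Real.norm_eq_abs]
      have := (hq _ ⟨norm_nonneg _, norm_lift_dirichletKernel_le (m := m) hχ⟩).1
      rwa [abs_mul, abs_norm] at this
    have h2 : ∀ᶠ M : ℕ in atTop, (M : ℝ)⁻¹ ^ n * ∑ j : Fin n → Fin M,
        ‖lift ℂ ℂ _ (gridHom j) (dirichletKernel m n)‖ ≤ C * (1 + ε) + ε := by
      filter_upwards [eventually_mean_gridHom (kernelTransform m n q * conjDirichletKernel m n),
        eventually_gt_atTop 0] with M hM hM0
      rw [coeff_mul_conjDirichletKernel] at hM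
      have h3 (j : Fin n → Fin M) :
          lift ℂ ℂ _ (gridHom j) (kernelTransform m n q * conjDirichletKernel m n) =
          ((‖lift ℂ ℂ _ (gridHom j) (dirichletKernel m n)‖ ^ 2 *
            q.eval (‖lift ℂ ℂ _ (gridHom j) (dirichletKernel m n)‖ ^ 2) : ℝ) : ℂ) := by
        rw [map_mul, lift_kernelTransform (norm_gridHom j),
          lift_conjDirichletKernel (norm_gridHom j), mul_right_comm, Complex.mul_conj,
          Complex.normSq_eq_norm_sq]
        push_cast
        rfl
      have h4 : (((M : ℝ)⁻¹ ^ n * ∑ j : Fin n → Fin M,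
          ‖lift ℂ ℂ _ (gridHom j) (dirichletKernel m n)‖ ^ 2 *
            q.eval (‖lift ℂ ℂ _ (gridHom j) (dirichletKernel m n)‖ ^ 2) : ℝ) : ℂ) =
          ∑ α ∈ degLE m n, (kernelTransform m n q).coeff (intExp α) := by
        rw [← hM]
        simp_rw [h3]
        push_cast
        rfl
      rw [← h4, Complex.norm_real] at h1
      have h5 := (le_abs_self _).trans h1
      have hM1 : ((M : ℝ)⁻¹ ^ n * ∑ _j : Fin n → Fin M, ε) = ε := by
        have : (M : ℝ) ≠ 0 := by positivity
        simp only [Finset.sum_const, Finset.card_univ, Fintype.card_fun, Fintype.card_fin,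
          nsmul_eq_mul]
        push_cast
        rw [← mul_assoc, ← mul_pow, inv_mul_cancel₀ this, one_pow, one_mul]
      calc _ ≤ (M : ℝ)⁻¹ ^ n * ∑ j : Fin n → Fin M,
            (‖lift ℂ ℂ _ (gridHom j) (dirichletKernel m n)‖ ^ 2 *
            q.eval (‖lift ℂ ℂ _ (gridHom j) (dirichletKernel m n)‖ ^ 2) + ε) := by
            gcongr with j _
            have := (hq _ ⟨norm_nonneg _,
              norm_lift_dirichletKernel_le (m := m) (norm_gridHom j)⟩).2
            linarith
        _ ≤ _ := by
            rw [Finset.sum_add_distrib, mul_add, hM1]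
            gcongr
    have h6 : Tendsto (fun M : ℕ => (1 + 2 * Real.pi * (m + 1) * m / M) ^ n * (C * (1 + ε) + ε))
        atTop (nhds (C * (1 + ε) + ε)) := by
      have := (((tendsto_const_div_atTop_nhds_zero_nat
        (2 * Real.pi * (m + 1) * m)).const_add 1).pow n).mul_const (C * (1 + ε) + ε)
      simpa using this
    refine ge_of_tendsto h6 ?_
    filter_upwards [h2, eventually_gt_atTop m] with M h2 hM
    refine Real.sqrt_le_iff.2 ⟨by positivity, (card_div_two_pow_le hM).trans ?_⟩
    gcongr
  have hlim : Tendsto (fun ε : ℝ => C * (1 + ε) + ε) (nhdsWithin 0 (Set.Ioi 0)) (nhds C) := by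
    have : Tendsto (fun ε : ℝ => C * (1 + ε) + ε) (nhds 0) (nhds (C * (1 + 0) + 0)) :=
      Continuous.tendsto (by fun_prop) 0
    simp only [add_zero, mul_one] at this
    exact this.mono_left nhdsWithin_le_nhds
  exact ge_of_tendsto hlim (eventually_mem_nhdsWithin.mono fun ε hε => key ε hε)

theorem le_relProjConst_axisEmbedding :
    ENNReal.ofReal (Real.sqrt ((degLE m n).card / 2 ^ m)) ≤
      relProjConst (LinearMap.range
        (axisEmbedding.{v} logFrequency (primePowIndices m n)).toLinearMap) := by
  refine le_iInf₂ fun P hP => ?_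
  rw [← ofReal_norm]
  refine ENNReal.ofReal_le_ofReal ?_
  let I := axisEmbedding.{v} logFrequency (primePowIndices m n)
  refine sqrt_card_div_two_pow_le
    (Q := I.equivRange.symm.toLinearEquiv.toLinearMap ∘ₗ P.toLinearMap) (fun D => ?_)
    (norm_nonneg P) fun y => ?_
  · change I.equivRange.symm (P (I.equivRange D : LinearMap.range I.toLinearMap)) = D
    rw [hP, LinearIsometryEquiv.symm_apply_apply]
  · exact (I.equivRange.symm.norm_map _).le.trans (P.le_opNorm y)

/-- A finite-dimensional range is complemented, so the embedding is admissible in the supremum;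
`ULift` places the target in the universe over which that supremum runs. -/
theorem le_projConst :
    ENNReal.ofReal (Real.sqrt ((degLE m n).card / 2 ^ m)) ≤
      projConst.{0, v} (HInf logFrequency (primePowIndices m n)) := by
  have := finiteDimensional_hInf (m := m) (n := n)
  set I := axisEmbedding.{v} logFrequency (primePowIndices m n) with hI
  have hfin : FiniteDimensional ℂ (LinearMap.range I.toLinearMap) := inferInstance
  refine le_iSup_of_le (ULift.{v} (ℝ →ᵇ ℂ)) <| le_iSup_of_le inferInstance <|
    le_iSup_of_le inferInstance <| le_iSup_of_le inferInstance <| le_iSup_of_le I <|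
    le_iSup_of_le (Submodule.ClosedComplemented.of_finiteDimensional _) ?_
  exact le_relProjConst_axisEmbedding

end Lower

theorem theorem2p11 (m n : ℕ) (hm : 1 ≤ m) (hn : 1 ≤ n) :
    ENNReal.ofReal
        (1 / Real.sqrt (2 ^ m) *
          Real.sqrt (∑ k ∈ Finset.range (m + 1), ((n + k - 1).choose k : ℝ))) ≤
      projConst.{0, v} (HInf logFrequency (primePowIndices m n)) ∧
    projConst.{0, v} (HInf logFrequency (primePowIndices m n)) ≤
      ENNReal.ofReal
        (Real.sqrt (∑ k ∈ Finset.range (m + 1), ((n + k - 1).choose k : ℝ))) := by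
  have hcard : ∑ k ∈ Finset.range (m + 1), ((n + k - 1).choose k : ℝ) = (degLE m n).card := by
    rw [card_degLE]
    push_cast
    rfl
  rw [hcard, one_div_mul_eq_div, ← Real.sqrt_div (Nat.cast_nonneg _)]
  exact ⟨le_projConst, projConst_le⟩
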